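/- Let $n\ge 1$ be an integer and let $k$ be a field whose characteristic does not divide $n$ and which contains all $n$-th roots of unity; let $\mathbf{B}\mu_{n,k}=[\operatorname{Spec}k/\mu_n]$ be the classifying stack of $\mu_n$ over $k$. An Azumaya algebra on $\mathbf{B}\mu_{n,k}$ is a quasi-coherent sheaf of $\mathcal{O}$-algebras that is étale locally isomorphic to $M_m(\mathcal{O})$ for some $m\ge 1$. The Brauer group $\mathrm{Br}(\mathbf{B}\mu_{n,k})$ is the set of Azumaya algebras modulo the relation $\mathcal{A}\sim\mathcal{B}$ if and only if $\mathcal{A}\otimes\mathcal{E}nd(E)\cong\mathcal{B}\otimes\mathcal{E}nd(F)$ for some vector bundles $E,F$ of positive rank, with $[\mathcal{A}]+[\mathcal{B}]=[\mathcal{A}\otimes\mathcal{B}]$. (By étale descent along $\operatorname{Spec}k\to\mathbf{B}\mu_{n,k}$, a quasi-coherent sheaf on $\mathbf{B}\mu_{n,k}$ is a $k$-vector space with a $k$-linear action of the finite group $\mu_n(k)$, and likewise for sheaves of algebras and for modules over them; coherent sheaves and vector bundles correspond to finite-dimensional spaces.) Let $\mathcal{A}$ and $\mathcal{B}$ be Azumaya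 algebras on $\mathbf{B}\mu_{n,k}$ that are Morita equivalent, i.e. the categories $\mathrm{Coh}(\mathbf{B}\mu_{n,k},\mathcal{A})$ and $\mathrm{Coh}(\mathbf{B}\mu_{n,k},\mathcal{B})$ of coherent right modules are equivalent as $k$-linear abelian categories. Then $[\mathcal{A}]$ and $[\mathcal{B}]$ have the same order in $\mathrm{Br}(\mathbf{B}\mu_{n,k})$. -/

import Mathlib

open scoped TensorProduct

universe u

/-!
Sheaves on the classifying stack `BG` of a finite group `G` over a field `k`.

The stack `BG = [Spec k / G]` (with `G` acting trivially on `Spec k`) has the finite etale atlas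
`Spec k ⟶ BG`, with `Spec k ×_{BG} Spec k = G × Spec k`.  A quasi-coherent sheaf on `BG` is a
quasi-coherent sheaf on the atlas with a descent datum for the groupoid `G × Spec k ⇉ Spec k`:
a `k`-vector space `V` with an isomorphism `V ≃ V` for every `g : G`, subject to the cocycle
condition, in other words a `G`-equivariant sheaf on `Spec k`.  Tensor products, sheaves of
endomorphisms, opposite algebras and modules over algebras are formed on the atlas, with the
induced descent data.  If `k` contains a primitive `n`-th root of unity, then the group scheme
`μ_n` over `k` is the constant group `G = rootsOfUnity n k`, and `BG = Bμ_{n,k}`.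
-/

namespace ClassifyingStack

/-- A vector bundle on `BG` of (constant) rank `> 0`: a nonzero finite-dimensional vector space
with a descent datum. -/
structure VectorBundle (G k : Type u) [Group G] [Field k] where
  carrier : Type u
  [addCommGroup : AddCommGroup carrier]
  [module : Module k carrier]
  [finite : Module.Finite k carrier]
  [nontrivial : Nontrivial carrier]
  /-- the descent datum -/
  act : G →* (carrier ≃ₗ[k] carrier)

attribute [instance] VectorBundle.addCommGroup VectorBundle.module VectorBundle.finite
  VectorBundle.nontrivial

/-- A quasi-coherent sheaf of (associative, unital) algebras on `BG`: a `k`-algebra with a descent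
datum that respects the algebra structure. -/
structure AlgebraSheaf (G k : Type u) [Group G] [Field k] where
  carrier : Type u
  [ring : Ring carrier]
  [algebra : Algebra k carrier]
  /-- the descent datum -/
  act : G →* (carrier ≃ₐ[k] carrier)

attribute [instance] AlgebraSheaf.ring AlgebraSheaf.algebra

variable {G k : Type u} [Group G] [Field k]

namespace AlgebraSheaf

/-- Isomorphisms of sheaves of algebras on `BG`. -/
structure Iso (A B : AlgebraSheaf G k) where
  toAlgEquiv : A.carrier ≃ₐ[k] B.carrier
  map_act : ∀ (g : G) (a : A.carrier), toAlgEquiv (A.act g a) = B.act g (toAlgEquiv a)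

/-- The structure sheaf of `BG`. -/
def structureSheaf (G k : Type u) [Group G] [Field k] : AlgebraSheaf G k where
  carrier := k
  act := 1

/-- The tensor product of two sheaves of algebras over the structure sheaf. -/
noncomputable def tensor (A B : AlgebraSheaf G k) : AlgebraSheaf G k where
  carrier := A.carrier ⊗[k] B.carrier
  act :=
    { toFun := fun g => Algebra.TensorProduct.congr (A.act g) (B.act g)
      map_one' := by
        apply AlgEquiv.coe_toAlgHom_injective
        ext <;> simp
      map_mul' := fun g h => by
        apply AlgEquiv.coe_toAlgHom_injective
        ext <;> simp }

/-- The opposite sheaf of algebras. -/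
def opposite (A : AlgebraSheaf G k) : AlgebraSheaf G k where
  carrier := A.carrierᵐᵒᵖ
  act :=
    { toFun := fun g => AlgEquiv.op (A.act g)
      map_one' := by rw [map_one]; rfl
      map_mul' := fun g h => by rw [map_mul]; rfl }

/-- The sheaf of endomorphisms of a vector bundle, with the descent datum
`f ↦ g ∘ f ∘ g⁻¹`. -/
def endomorphisms (E : VectorBundle G k) : AlgebraSheaf G k where
  carrier := Module.End k E.carrier
  act :=
    { toFun := fun g => (E.act g).conjAlgEquiv k
      map_one' := by
        ext f x
        simp [LinearEquiv.conjAlgEquiv_apply]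
        rfl
      map_mul' := fun g h => by
        ext f x
        simp [LinearEquiv.conjAlgEquiv_apply]
        rfl }

/-- A sheaf of algebras on `BG` is Azumaya if it is etale locally on `BG` isomorphic to the sheaf
of `m × m` matrices for some `m ≥ 1`: there is a nonempty affine scheme `Spec S`, etale over the
atlas `Spec k`, such that the pullback to the etale cover `Spec S ⟶ Spec k ⟶ BG` is isomorphic to
`M_m(S)`. -/
def IsAzumaya (A : AlgebraSheaf G k) : Prop :=
  ∃ (S : Type u) (_ : CommRing S) (_ : Algebra k S) (_ : Algebra.Etale k S) (_ : Nontrivial S)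
    (m : ℕ), 1 ≤ m ∧ Nonempty ((S ⊗[k] A.carrier) ≃ₐ[S] Matrix (Fin m) (Fin m) S)

end AlgebraSheaf

/-- Azumaya algebras on `BG`. -/
structure Azumaya (G k : Type u) [Group G] [Field k] extends AlgebraSheaf G k where
  isAzumaya : toAlgebraSheaf.IsAzumaya

/-! ### Coherent modules and Morita equivalence -/

/-- A coherent right module over a sheaf of algebras `A` on `BG`: a finite-dimensional vector space
that is a right module over the algebra, with a descent datum compatible with the one of `A`. -/
structure CohMod (A : AlgebraSheaf G k) where
  carrier : Type u
  [addCommGroup : AddCommGroup carrier]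
  [module : Module k carrier]
  [finite : Module.Finite k carrier]
  [rightModule : Module A.carrierᵐᵒᵖ carrier]
  [isScalarTower : IsScalarTower k A.carrierᵐᵒᵖ carrier]
  /-- the descent datum -/
  act : G →* (carrier ≃ₗ[k] carrier)
  act_smul : ∀ (g : G) (a : A.carrier) (x : carrier),
    act g (MulOpposite.op a • x) = MulOpposite.op (A.act g a) • act g x

attribute [instance] CohMod.addCommGroup CohMod.module CohMod.finite CohMod.rightModule
  CohMod.isScalarTower

namespace CohMod

variable {A : AlgebraSheaf G k}

/-- Morphisms of coherent right `A`-modules, as a `k`-subspace of the `k`-linear maps: the maps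
that are linear over `A` and compatible with the descent data. -/
def homs (M N : CohMod A) : Submodule k (M.carrier →ₗ[k] N.carrier) where
  carrier := {f | (∀ (a : A.carrier) (x : M.carrier),
      f (MulOpposite.op a • x) = MulOpposite.op a • f x) ∧
    ∀ (g : G) (x : M.carrier), f (M.act g x) = N.act g (f x)}
  add_mem' := fun {f f'} hf hf' =>
    ⟨fun a x => by simp [hf.1, hf'.1], fun g x => by simp [hf.2, hf'.2]⟩
  zero_mem' := ⟨fun a x => by simp, fun g x => by simp⟩
  smul_mem' := fun c f hf =>
    ⟨fun a x => by
      have : SMulCommClass k A.carrierᵐᵒᵖ N.carrier := IsScalarTower.to_smulCommClass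
      simp [hf.1, smul_comm c (MulOpposite.op a)], fun g x => by simp [hf.2]⟩

/-- The category `Coh(BG, A)` of coherent right `A`-modules. -/
instance : CategoryTheory.Category.{u} (CohMod A) where
  Hom M N := homs M N
  id M := ⟨LinearMap.id, fun _ _ => rfl, fun _ _ => rfl⟩
  comp f f' := ⟨f'.1 ∘ₗ f.1, fun a x => by simp [f.2.1, f'.2.1],
    fun g x => by simp [f.2.2, f'.2.2]⟩

instance : CategoryTheory.Preadditive (CohMod A) where
  homGroup M N := inferInstanceAs (AddCommGroup (homs M N))
  add_comp _ _ _ f f' h := Subtype.ext (LinearMap.comp_add f.1 f'.1 h.1)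
  comp_add _ _ _ f h h' := Subtype.ext (LinearMap.add_comp f.1 h'.1 h.1)

instance : CategoryTheory.Linear k (CohMod A) where
  homModule M N := inferInstanceAs (Module k (homs M N))
  smul_comp _ _ _ r f h := Subtype.ext (LinearMap.comp_smul h.1 r f.1)
  comp_smul _ _ _ f r h := Subtype.ext (LinearMap.smul_comp r h.1 f.1)

end CohMod

/-- Morita equivalence: `Coh(BG, A)` and `Coh(BG, B)` are equivalent as `k`-linear (abelian)
categories. -/
def MoritaEquivalent (A B : AlgebraSheaf G k) : Prop :=
  ∃ e : CategoryTheory.Equivalence (CohMod A) (CohMod B),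
    e.functor.Additive ∧ CategoryTheory.Functor.Linear k e.functor

/-! ### The Brauer group -/

namespace AlgebraSheaf

namespace Iso

variable {A B C A' B' : AlgebraSheaf G k}

def refl (A : AlgebraSheaf G k) : Iso A A := ⟨AlgEquiv.refl, fun _ _ => rfl⟩

def symm (e : Iso A B) : Iso B A :=
  ⟨e.toAlgEquiv.symm, fun g b => by
    apply e.toAlgEquiv.injective
    rw [e.map_act]; simp⟩

def trans (e : Iso A B) (f : Iso B C) : Iso A C :=
  ⟨e.toAlgEquiv.trans f.toAlgEquiv, fun g a => by simp [e.map_act, f.map_act]⟩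

theorem tensor_act_tmul (g : G) (a : A.carrier) (b : B.carrier) :
    (A.tensor B).act g (a ⊗ₜ[k] b) = A.act g a ⊗ₜ[k] B.act g b := rfl

/-- An isomorphism out of a tensor product is compatible with the descent data if it is so on pure
tensors. -/
def ofTensor (e : (A.carrier ⊗[k] B.carrier) ≃ₐ[k] C.carrier)
    (h : ∀ (g : G) (a : A.carrier) (b : B.carrier),
      e (A.act g a ⊗ₜ[k] B.act g b) = C.act g (e (a ⊗ₜ[k] b))) : Iso (A.tensor B) C where
  toAlgEquiv := e
  map_act g x := by
    have key : (e : (A.carrier ⊗[k] B.carrier) →ₐ[k] C.carrier).comp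
        (Algebra.TensorProduct.congr (A.act g) (B.act g) :
          (A.carrier ⊗[k] B.carrier) →ₐ[k] (A.carrier ⊗[k] B.carrier)) =
        (C.act g : C.carrier →ₐ[k] C.carrier).comp e :=
      Algebra.TensorProduct.ext' fun a b => h g a b
    exact DFunLike.congr_fun key x

noncomputable def tensorCongr (e : Iso A A') (f : Iso B B') :
    Iso (A.tensor B) (A'.tensor B') :=
  ofTensor (Algebra.TensorProduct.congr e.toAlgEquiv f.toAlgEquiv) fun g a b => by
    change e.toAlgEquiv (A.act g a) ⊗ₜ[k] f.toAlgEquiv (B.act g b) =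
      A'.act g (e.toAlgEquiv a) ⊗ₜ[k] B'.act g (f.toAlgEquiv b)
    rw [e.map_act, f.map_act]

noncomputable def tensorComm (A B : AlgebraSheaf G k) : Iso (A.tensor B) (B.tensor A) :=
  ofTensor (Algebra.TensorProduct.comm k A.carrier B.carrier) fun _ _ _ => rfl

noncomputable def tensorAssoc (A B C : AlgebraSheaf G k) :
    Iso ((A.tensor B).tensor C) (A.tensor (B.tensor C)) :=
  ofTensor (Algebra.TensorProduct.assoc k k k A.carrier B.carrier C.carrier) fun g x c => by
    let i : (A.tensor B).carrier →ₗ[k] (A.tensor (B.tensor C)).carrier :=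
      (Algebra.TensorProduct.assoc k k k A.carrier B.carrier C.carrier).toLinearMap ∘ₗ
        (TensorProduct.mk k (A.carrier ⊗[k] B.carrier) C.carrier).flip (C.act g c) ∘ₗ
        ((A.tensor B).act g).toLinearMap
    let j : (A.tensor B).carrier →ₗ[k] (A.tensor (B.tensor C)).carrier :=
      ((A.tensor (B.tensor C)).act g).toLinearMap ∘ₗ
      (Algebra.TensorProduct.assoc k k k A.carrier B.carrier C.carrier).toLinearMap ∘ₗ
        (TensorProduct.mk k (A.carrier ⊗[k] B.carrier) C.carrier).flip c
    have key : i = j := TensorProduct.ext' fun a b => rfl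
    exact DFunLike.congr_fun key x

noncomputable def unitTensor (A : AlgebraSheaf G k) : Iso ((structureSheaf G k).tensor A) A :=
  ofTensor (Algebra.TensorProduct.lid k A.carrier) fun g a b => by
    change (show k from a) • A.act g b = A.act g ((show k from a) • b)
    rw [map_smul]

end Iso

end AlgebraSheaf

namespace VectorBundle

/-- The trivial line bundle. -/
def trivial (G k : Type u) [Group G] [Field k] : VectorBundle G k where
  carrier := k
  act := 1

/-- The tensor product of vector bundles. -/
noncomputable def tensor (E F : VectorBundle G k) : VectorBundle G k where
  carrier := E.carrier ⊗[k] F.carrier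
  act :=
    { toFun := fun g => TensorProduct.congr (E.act g) (F.act g)
      map_one' := by
        apply LinearEquiv.toLinearMap_injective
        ext; simp
      map_mul' := fun g h => by
        apply LinearEquiv.toLinearMap_injective
        ext; simp }

end VectorBundle

namespace AlgebraSheaf

theorem endomorphisms_act (E : VectorBundle G k) (g : G) (f : Module.End k E.carrier) :
    (endomorphisms E).act g f =
      (E.act g).toLinearMap ∘ₗ f ∘ₗ (E.act g).symm.toLinearMap := rfl

/-- `End(E) ⊗ End(F) ≅ End(E ⊗ F)` -/
noncomputable def endTensor (E F : VectorBundle G k) :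
    Iso ((endomorphisms E).tensor (endomorphisms F)) (endomorphisms (E.tensor F)) :=
  Iso.ofTensor (AlgEquiv.ofBijective
    (Module.endTensorEndAlgHom (R := k) (S := k) (A := k) (M := E.carrier) (N := F.carrier)) (by
      have h := (homTensorHomEquiv k E.carrier F.carrier E.carrier F.carrier).bijective
      have h' : ⇑(homTensorHomEquiv k E.carrier F.carrier E.carrier F.carrier) =
          ⇑(Module.endTensorEndAlgHom (R := k) (S := k) (A := k) (M := E.carrier)
            (N := F.carrier)) := by
        funext x
        rw [homTensorHomEquiv_apply]
        rfl
      rwa [h'] at h)) fun g f f' => by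
    refine TensorProduct.ext' fun x y => ?_
    rfl

/-- `End(O) ≅ O` -/
noncomputable def endTrivial :
    Iso (structureSheaf G k) (endomorphisms (VectorBundle.trivial G k)) where
  toAlgEquiv := (AlgEquiv.toOpposite k k).trans (AlgEquiv.moduleEndSelf k)
  map_act _ _ := rfl

/-- Brauer equivalence. -/
def BrauerEquivalent (A B : AlgebraSheaf G k) : Prop :=
  ∃ E F : VectorBundle G k,
    Nonempty (Iso (A.tensor (endomorphisms E)) (B.tensor (endomorphisms F)))

namespace BrauerEquivalent

variable {A B C A' B' : AlgebraSheaf G k}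

theorem of_iso (e : Iso A B) : BrauerEquivalent A B :=
  ⟨.trivial G k, .trivial G k, ⟨e.tensorCongr (.refl _)⟩⟩

theorem symm : BrauerEquivalent A B → BrauerEquivalent B A :=
  fun ⟨E, F, ⟨e⟩⟩ => ⟨F, E, ⟨e.symm⟩⟩

theorem trans : BrauerEquivalent A B → BrauerEquivalent B C → BrauerEquivalent A C := by
  rintro ⟨E, F, ⟨e⟩⟩ ⟨E', F', ⟨e'⟩⟩
  refine ⟨E.tensor E', F'.tensor F, ⟨?_⟩⟩
  refine (Iso.tensorCongr (.refl A) (endTensor E E').symm).trans ?_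
  refine (Iso.tensorAssoc _ _ _).symm.trans ?_
  refine (e.tensorCongr (.refl _)).trans ?_
  refine (Iso.tensorAssoc _ _ _).trans ?_
  refine (Iso.tensorCongr (.refl B) (Iso.tensorComm _ _)).trans ?_
  refine (Iso.tensorAssoc _ _ _).symm.trans ?_
  refine (e'.tensorCongr (.refl _)).trans ?_
  refine (Iso.tensorAssoc _ _ _).trans ?_
  exact Iso.tensorCongr (.refl C) (endTensor F' F)

theorem tensor_right (h : BrauerEquivalent A B) (C : AlgebraSheaf G k) :
    BrauerEquivalent (A.tensor C) (B.tensor C) := by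
  obtain ⟨E, F, ⟨e⟩⟩ := h
  have aux : ∀ (X Y : AlgebraSheaf G k), Nonempty
      (Iso ((X.tensor C).tensor Y) ((X.tensor Y).tensor C)) := fun X Y =>
    ⟨(Iso.tensorAssoc _ _ _).trans <| (Iso.tensorCongr (.refl X) (Iso.tensorComm _ _)).trans
      (Iso.tensorAssoc _ _ _).symm⟩
  exact ⟨E, F, ⟨((aux _ _).some.trans (e.tensorCongr (.refl C))).trans (aux _ _).some.symm⟩⟩

theorem tensor (h : BrauerEquivalent A A') (h' : BrauerEquivalent B B') :
    BrauerEquivalent (A.tensor B) (A'.tensor B') :=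
  (h.tensor_right B).trans <| (of_iso (Iso.tensorComm _ _)).trans <|
    (h'.tensor_right A').trans (of_iso (Iso.tensorComm _ _))

end BrauerEquivalent

theorem structureSheaf_isAzumaya : (structureSheaf G k).IsAzumaya :=
  ⟨k, inferInstance, inferInstance, inferInstance, inferInstance, 1, le_rfl,
    ⟨(Algebra.TensorProduct.lid k k).trans
      (AlgEquiv.ofRingEquiv (f := (Matrix.uniqueRingEquiv (m := Fin 1) (A := k)).symm) fun r => by
        ext i j
        rw [Subsingleton.elim i j, Matrix.algebraMap_matrix_apply, if_pos rfl]
        rfl)⟩⟩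

/-- `T ⊗_S M_m(S) ≅ M_m(T)` over `T`. -/
noncomputable def matrixBaseChange (S T : Type u) [CommRing S] [CommRing T] [Algebra S T] (m : ℕ) :
    (T ⊗[S] Matrix (Fin m) (Fin m) S) ≃ₐ[T] Matrix (Fin m) (Fin m) T :=
  AlgEquiv.ofRingEquiv (f := (matrixEquivTensor (Fin m) S T).symm.toRingEquiv) fun t => by
    change (matrixEquivTensor (Fin m) S T).symm (t ⊗ₜ 1) = _
    rw [matrixEquivTensor_apply_symm, Matrix.map_one _ (map_zero _) (map_one _),
      Algebra.algebraMap_eq_smul_one]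

/-- `T' ⊗_S (S ⊗_k A) ≅ T' ⊗_k A` over `T`, for noncommutative `A` and `T'`. -/
noncomputable def cancelBaseChange (S T T' A : Type u) [CommRing S] [CommRing T] [Ring T']
    [Ring A] [Algebra k S] [Algebra k T'] [Algebra k A] [Algebra S T] [Algebra S T']
    [Algebra T T'] [IsScalarTower k S T'] [IsScalarTower S T T'] [Algebra k T]
    [IsScalarTower k T T'] :
    (T' ⊗[S] (S ⊗[k] A)) ≃ₐ[T] (T' ⊗[k] A) :=
  AlgEquiv.symm <| AlgEquiv.ofLinearEquiv
    (TensorProduct.AlgebraTensorModule.cancelBaseChange k S T T' A).symm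
    (by simp [Algebra.TensorProduct.one_def]) <|
      LinearMap.map_mul_of_map_mul_tmul (fun _ _ _ _ => by simp)

/-- A splitting may be pulled back along `S ⟶ T`. -/
theorem split_baseChange (A : Type u) [Ring A] [Algebra k A] (S T : Type u) [CommRing S]
    [Algebra k S] [CommRing T] [Algebra k T] [Algebra S T] [IsScalarTower k S T] {m : ℕ}
    (e : (S ⊗[k] A) ≃ₐ[S] Matrix (Fin m) (Fin m) S) :
    Nonempty ((T ⊗[k] A) ≃ₐ[T] Matrix (Fin m) (Fin m) T) :=
  ⟨(cancelBaseChange (k := k) S T T A).symm.trans <|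
    (Algebra.TensorProduct.congr (AlgEquiv.refl (R := T) (A₁ := T)) e).trans
      (matrixBaseChange S T m)⟩

theorem split_tensor (A B : Type u) [Ring A] [Algebra k A] [Ring B] [Algebra k B]
    (T : Type u) [CommRing T] [Algebra k T] {m l : ℕ}
    (e : (T ⊗[k] A) ≃ₐ[T] Matrix (Fin m) (Fin m) T)
    (f : (T ⊗[k] B) ≃ₐ[T] Matrix (Fin l) (Fin l) T) :
    Nonempty ((T ⊗[k] (A ⊗[k] B)) ≃ₐ[T] Matrix (Fin (m * l)) (Fin (m * l)) T) :=
  ⟨(Algebra.TensorProduct.assoc k k T T A B).symm.trans <|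
    (cancelBaseChange (k := k) T T (T ⊗[k] A) B).symm.trans <|
    (Algebra.TensorProduct.congr e f).trans <|
    (Matrix.kroneckerAlgEquiv (Fin m) (Fin l) T).trans
      (Matrix.reindexAlgEquiv T T finProdFinEquiv)⟩

theorem IsAzumaya.tensor {A B : AlgebraSheaf G k} (hA : A.IsAzumaya) (hB : B.IsAzumaya) :
    (A.tensor B).IsAzumaya := by
  obtain ⟨S, _, _, _, _, m, hm, ⟨e⟩⟩ := hA
  obtain ⟨T, _, _, _, _, l, hl, ⟨f⟩⟩ := hB
  let _ : Algebra T (S ⊗[k] T) := Algebra.TensorProduct.rightAlgebra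
  obtain ⟨e'⟩ := split_baseChange A.carrier S (S ⊗[k] T) e
  obtain ⟨f'⟩ := split_baseChange B.carrier T (S ⊗[k] T) f
  exact ⟨S ⊗[k] T, inferInstance, inferInstance, Algebra.Etale.comp k S (S ⊗[k] T), inferInstance,
    m * l, Nat.mul_pos hm hl, split_tensor A.carrier B.carrier (S ⊗[k] T) e' f'⟩

theorem split_opposite (A : Type u) [Ring A] [Algebra k A] (S : Type u) [CommRing S]
    [Algebra k S] {m : ℕ} (e : (S ⊗[k] A) ≃ₐ[S] Matrix (Fin m) (Fin m) S) :
    Nonempty ((S ⊗[k] Aᵐᵒᵖ) ≃ₐ[S] Matrix (Fin m) (Fin m) S) :=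
  ⟨(Algebra.TensorProduct.congr (AlgEquiv.toOpposite S S) AlgEquiv.refl).trans <|
    (Algebra.TensorProduct.opAlgEquiv k S S A).trans <|
    (AlgEquiv.op e).trans (Matrix.transposeAlgEquiv (Fin m) S S).symm⟩

theorem IsAzumaya.opposite {A : AlgebraSheaf G k} (hA : A.IsAzumaya) : A.opposite.IsAzumaya := by
  obtain ⟨S, _, _, _, _, m, hm, ⟨e⟩⟩ := hA
  exact ⟨S, inferInstance, inferInstance, inferInstance, inferInstance, m, hm,
    split_opposite A.carrier S e⟩

theorem IsAzumaya.finite {A : AlgebraSheaf G k} (hA : A.IsAzumaya) :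
    Module.Finite k A.carrier := by
  obtain ⟨S, _, _, _, _, m, hm, ⟨e⟩⟩ := hA
  have : Module.Finite S (S ⊗[k] A.carrier) := Module.Finite.equiv e.symm.toLinearEquiv
  exact Module.Finite.of_finite_tensorProduct_of_faithfullyFlat S

/-- Algebra homomorphisms from an Azumaya algebra to a nonzero algebra are injective. -/
theorem IsAzumaya.injective {A : AlgebraSheaf G k} (hA : A.IsAzumaya) {C : Type u} [Ring C]
    [Algebra k C] [Nontrivial C] (f : A.carrier →ₐ[k] C) : Function.Injective f := by
  obtain ⟨S, _, _, _, _, m, hm, ⟨e⟩⟩ := hA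
  obtain ⟨I, hI⟩ := Ideal.exists_maximal S
  let _ : Field (S ⧸ I) := Ideal.Quotient.field I
  obtain ⟨e'⟩ := split_baseChange A.carrier S (S ⧸ I) e
  have : Nonempty (Fin m) := ⟨⟨0, hm⟩⟩
  let φ : ((S ⧸ I) ⊗[k] A.carrier) →ₐ[S ⧸ I] ((S ⧸ I) ⊗[k] C) :=
    Algebra.TensorProduct.map (AlgHom.id _ _) f
  have hφ : Function.Injective (φ.comp e'.symm.toAlgHom) :=
    RingHom.injective (φ.comp e'.symm.toAlgHom).toRingHom
  have hφ' : Function.Injective φ := by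
    have := hφ.comp e'.injective
    convert this using 1
    ext x
    simp
  exact (Module.FaithfullyFlat.lTensor_injective_iff_injective k (S ⧸ I) (f := f.toLinearMap)).1 hφ'

theorem IsAzumaya.nontrivial {A : AlgebraSheaf G k} (hA : A.IsAzumaya) :
    Nontrivial A.carrier := by
  obtain ⟨S, _, _, _, _, m, hm, ⟨e⟩⟩ := hA
  have : Nonempty (Fin m) := ⟨⟨0, hm⟩⟩
  by_contra h
  rw [not_nontrivial_iff_subsingleton] at h
  have h1 : (1 : S ⊗[k] A.carrier) = 0 := by
    rw [Algebra.TensorProduct.one_def, Subsingleton.elim (1 : A.carrier) 0, TensorProduct.tmul_zero]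
  exact one_ne_zero (by rw [← map_one e, h1, map_zero] : (1 : Matrix (Fin m) (Fin m) S) = 0)

/-- The underlying vector bundle of an Azumaya algebra. -/
def IsAzumaya.toVectorBundle {A : AlgebraSheaf G k} (hA : A.IsAzumaya) : VectorBundle G k :=
  letI := hA.finite
  letI := hA.nontrivial
  { carrier := A.carrier
    act :=
      { toFun := fun g => (A.act g).toLinearEquiv
        map_one' := by rw [map_one]; rfl
        map_mul' := fun g h => by rw [map_mul]; rfl } }

theorem IsAzumaya.tensor_opposite {A : AlgebraSheaf G k} (hA : A.IsAzumaya) :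
    BrauerEquivalent (A.tensor A.opposite) (structureSheaf G k) := by
  have := hA.finite
  have := hA.nontrivial
  let f : (A.tensor A.opposite).carrier →ₐ[k] Module.End k A.carrier :=
    AlgHom.mulLeftRight k A.carrier
  have hinj : Function.Injective f := (hA.tensor hA.opposite).injective f
  have hfin : Module.finrank k (A.tensor A.opposite).carrier =
      Module.finrank k (Module.End k A.carrier) := by
    change Module.finrank k (A.carrier ⊗[k] A.carrierᵐᵒᵖ) = _
    rw [Module.finrank_tensorProduct, Module.finrank_linearMap,
      (MulOpposite.opLinearEquiv k : A.carrier ≃ₗ[k] A.carrierᵐᵒᵖ).finrank_eq]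
  have : Module.Finite k (A.tensor A.opposite).carrier := (hA.tensor hA.opposite).finite
  have hbij : Function.Bijective f :=
    ⟨hinj, (LinearMap.injective_iff_surjective_of_finrank_eq_finrank (f := f.toLinearMap) hfin).1
      hinj⟩
  have aux : ∀ (σ : A.carrier ≃ₐ[k] A.carrier) (a : A.carrier) (b : A.carrierᵐᵒᵖ) (x : A.carrier),
      AlgHom.mulLeftRight k A.carrier (σ a ⊗ₜ MulOpposite.op (σ b.unop)) x =
        σ (AlgHom.mulLeftRight k A.carrier (a ⊗ₜ b) (σ.symm x)) := fun σ a b x => by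
    simp [AlgHom.mulLeftRight_apply]
  let e : Iso (A.tensor A.opposite) (endomorphisms hA.toVectorBundle) :=
    Iso.ofTensor (AlgEquiv.ofBijective f hbij) fun g a b =>
      LinearMap.ext fun x => aux (A.act g) a b x
  exact ⟨.trivial G k, hA.toVectorBundle, ⟨(e.tensorCongr endTrivial.symm).trans
    (Iso.tensorComm _ _)⟩⟩

end AlgebraSheaf

namespace Azumaya

/-- Brauer equivalence of Azumaya algebras: `A ⊗ End(E) ≅ B ⊗ End(F)` for some vector bundles `E`
and `F`. -/
def brauerSetoid (G k : Type u) [Group G] [Field k] : Setoid (Azumaya G k) where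
  r A B := A.toAlgebraSheaf.BrauerEquivalent B.toAlgebraSheaf
  iseqv := ⟨fun _ => .of_iso (.refl _), fun h => h.symm, fun h h' => h.trans h'⟩

end Azumaya

/-- The Brauer group `Br(BG)`: Azumaya algebras on `BG` modulo Brauer equivalence. -/
def Br (G k : Type u) [Group G] [Field k] : Type (u + 1) :=
  Quotient (Azumaya.brauerSetoid G k)

/-- The class `[A]` in the Brauer group. -/
def Azumaya.brauerClass (A : Azumaya G k) : Br G k :=
  Quotient.mk (Azumaya.brauerSetoid G k) A

namespace Br

open AlgebraSheaf

/-- `[A] + [B] = [A ⊗ B]` -/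
noncomputable instance : Add (Br G k) :=
  ⟨Quotient.map₂ (fun A B => ⟨A.tensor B.toAlgebraSheaf, A.isAzumaya.tensor B.isAzumaya⟩)
    fun _ _ h _ _ h' => BrauerEquivalent.tensor h h'⟩

/-- `0 = [O]` -/
instance : Zero (Br G k) :=
  ⟨Azumaya.brauerClass ⟨structureSheaf G k, structureSheaf_isAzumaya⟩⟩

/-- `-[A] = [Aᵒᵖ]` -/
instance : Neg (Br G k) :=
  ⟨Quotient.map (fun A => ⟨A.opposite, A.isAzumaya.opposite⟩) fun A B h => by
    change BrauerEquivalent A.opposite B.opposite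
    have hAB : BrauerEquivalent A.toAlgebraSheaf B.toAlgebraSheaf := h
    have unit : ∀ X : AlgebraSheaf G k, BrauerEquivalent (X.tensor (structureSheaf G k)) X :=
      fun X => .of_iso ((Iso.tensorComm _ _).trans (Iso.unitTensor X))
    refine (unit _).symm.trans ?_
    refine (BrauerEquivalent.tensor (.of_iso (.refl _)) B.isAzumaya.tensor_opposite.symm).trans ?_
    refine (BrauerEquivalent.of_iso (Iso.tensorAssoc _ _ _).symm).trans ?_
    refine (BrauerEquivalent.tensor_right ?_ _).trans (.of_iso (Iso.unitTensor _))
    refine (BrauerEquivalent.tensor (.of_iso (.refl _)) hAB.symm).trans ?_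
    exact (BrauerEquivalent.of_iso (Iso.tensorComm _ _)).trans A.isAzumaya.tensor_opposite⟩

noncomputable instance : AddCommGroup (Br G k) where
  add_assoc := by
    rintro ⟨A⟩ ⟨B⟩ ⟨C⟩
    exact Quotient.sound (BrauerEquivalent.of_iso (Iso.tensorAssoc _ _ _))
  zero_add := by
    rintro ⟨A⟩
    exact Quotient.sound (BrauerEquivalent.of_iso (Iso.unitTensor _))
  add_zero := by
    rintro ⟨A⟩
    exact Quotient.sound
      (BrauerEquivalent.of_iso ((Iso.tensorComm _ _).trans (Iso.unitTensor _)))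
  add_comm := by
    rintro ⟨A⟩ ⟨B⟩
    exact Quotient.sound (BrauerEquivalent.of_iso (Iso.tensorComm _ _))
  neg_add_cancel := by
    rintro ⟨A⟩
    exact Quotient.sound
      ((BrauerEquivalent.of_iso (Iso.tensorComm _ _)).trans A.isAzumaya.tensor_opposite)
  nsmul := nsmulRec
  zsmul := zsmulRec

end Br

end ClassifyingStack

/-! The two classes agree after multiplication by an integer e that divides the order of each of
them. This forces equal orders.

The integer comes from a simple module. A Morita equivalence carries a simple module M over A to a
simple module N over B with the same endomorphism division algebra D
(`MoritaEquivalent.exists_end`). Let L be the centre of D and e = [L:k]. The group is cyclic,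
generated by g, and by Skolem–Noether g acts on A as conjugation by a unit u with u^n = a in k. The
operator x ↦ (gx)u on M is A-linear and commutes with g and with D, so it is an element t of L with
t^n = a. As g acts on M as t followed by u⁻¹, M is already simple over L ⊗ Aᵐᵒᵖ, and density gives L
⊗ Aᵐᵒᵖ ≅ End_D(M) (`IsSimpleWithEnd.repTensor_surjective`). The same argument over k(t) shows L =
k(t), so L/k is a cyclic Kummer extension.

e[A] = e[B]: Hom_D(M, N) is an L-vector space on which A ⊗ Bᵐᵒᵖ acts equivariantly, of the dimension
that makes it a splitting over L. A class split equivariantly over L is killed by e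
(`Azumaya.nsmul_brauerClass_eq_zero`): a generator σ of the Galois group lifts to a σ-semilinear
operator ψ, with ψ^e = c in k, that commutes with the group up to e-th roots of unity. Passing to
the e-th tensor power replaces c by c^e and kills these roots of unity. The c-eigenspace of the new
operator is then an equivariant splitting over k.

e divides the orders: the class of a modulo n-th powers is multiplicative and trivial on trivial
Brauer classes (`IsConjBy.exists_pow_eq_of_brauerClass_eq_zero`), so m[A] = 0 makes a^m an n-th
power in k, and Kummer theory gives e ∣ m (`dvd_of_pow_eq`). The argument is symmetric in A and B.
-/

namespace ClassifyingStack

variable {G k : Type u} [Group G] [Field k]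

/-! ### Splitting representations, Skolem–Noether and centrality over a field -/

namespace AlgebraSheaf

/-- The extension of scalars of a sheaf of algebras, with its descent datum forgotten. -/
noncomputable def extendScalars (A : AlgebraSheaf G k) (L : Type u) [Field L] [Algebra k L] :
    AlgebraSheaf PUnit.{u + 1} L where
  carrier := L ⊗[k] A.carrier
  act := 1

theorem IsAzumaya.extendScalars {A : AlgebraSheaf G k} (hA : A.IsAzumaya) (L : Type u) [Field L]
    [Algebra k L] : (A.extendScalars L).IsAzumaya := by
  obtain ⟨S, _, _, _, _, m, hm, ⟨e⟩⟩ := hA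
  let _ : Algebra S (L ⊗[k] S) := Algebra.TensorProduct.rightAlgebra
  obtain ⟨e'⟩ := split_baseChange A.carrier S (L ⊗[k] S) e
  exact ⟨L ⊗[k] S, inferInstance, inferInstance, inferInstance, inferInstance, m, hm,
    ⟨(cancelBaseChange (k := k) L (L ⊗[k] S) (L ⊗[k] S) A.carrier).trans e'⟩⟩

section Splitting

variable {X : AlgebraSheaf G k} {L : Type u} [Field L] [Algebra k L]
  {V W : Type u} [AddCommGroup V] [Module k V] [Module L V] [IsScalarTower k L V]
  [AddCommGroup W] [Module k W] [Module L W] [IsScalarTower k L W]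

/-- The extension of a representation over `k` in an `L`-vector space to `L ⊗ X`. -/
noncomputable def liftScalars (ρ : X.carrier →ₐ[k] Module.End L V) :
    (L ⊗[k] X.carrier) →ₐ[L] Module.End L V :=
  Algebra.TensorProduct.lift (Algebra.ofId L (Module.End L V)) ρ fun l x => Algebra.commutes l (ρ x)

theorem liftScalars_tmul (ρ : X.carrier →ₐ[k] Module.End L V) (l : L) (x : X.carrier) :
    liftScalars ρ (l ⊗ₜ x) = l • ρ x := by
  refine (Algebra.TensorProduct.lift_tmul _ _ _ _ _).trans ?_
  rw [Algebra.ofId_apply, Algebra.smul_def]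

theorem IsAzumaya.liftScalars_injective (hX : X.IsAzumaya) [Nontrivial V]
    (ρ : X.carrier →ₐ[k] Module.End L V) : Function.Injective (liftScalars ρ) :=
  (hX.extendScalars L).injective (C := Module.End L V) (liftScalars ρ)

/-- The hypothesis `h` is what makes V a splitting module: L ⊗ X embeds in End_L(V), and both sides
have the same L-dimension. -/
theorem IsAzumaya.liftScalars_bijective (hX : X.IsAzumaya) [Nontrivial V] [Module.Finite L V]
    (ρ : X.carrier →ₐ[k] Module.End L V)
    (h : Module.finrank L V ^ 2 = Module.finrank k X.carrier) :
    Function.Bijective (liftScalars ρ) := by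
  have := hX.finite
  refine ⟨hX.liftScalars_injective ρ, ?_⟩
  refine (LinearMap.injective_iff_surjective_of_finrank_eq_finrank
    (f := (liftScalars ρ).toLinearMap) ?_).1 (hX.liftScalars_injective ρ)
  rw [Module.finrank_baseChange, Module.finrank_linearMap, ← h, sq]

/-- Two splitting representations of an Azumaya algebra over a field are isomorphic. -/
theorem IsAzumaya.exists_intertwiner (hX : X.IsAzumaya) [Nontrivial V] [Module.Finite L V]
    [Nontrivial W] [Module.Finite L W]
    (ρ : X.carrier →ₐ[k] Module.End L V) (τ : X.carrier →ₐ[k] Module.End L W)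
    (hV : Module.finrank L V ^ 2 = Module.finrank k X.carrier)
    (hW : Module.finrank L W ^ 2 = Module.finrank k X.carrier) :
    ∃ T : V ≃ₗ[L] W, ∀ x v, T (ρ x v) = τ x (T v) := by
  let e := AlgEquiv.ofBijective _ (hX.liftScalars_bijective ρ hV)
  let f := AlgEquiv.ofBijective _ (hX.liftScalars_bijective τ hW)
  -- Both End_L(V) and End_L(W) are identified with L ⊗ X, and an isomorphism between endomorphism
  -- algebras is conjugation by a linear equivalence.
  obtain ⟨T, hT⟩ := (e.symm.trans f).eq_linearEquivConjAlgEquiv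
  refine ⟨T, fun x v => ?_⟩
  have h1 : e (1 ⊗ₜ x) = ρ x := (liftScalars_tmul ρ 1 x).trans (one_smul L _)
  have h2 : f (1 ⊗ₜ x) = τ x := (liftScalars_tmul τ 1 x).trans (one_smul L _)
  have h := DFunLike.congr_fun hT (ρ x)
  rw [AlgEquiv.trans_apply, ← h1, AlgEquiv.symm_apply_apply, h1, h2] at h
  rw [h]
  simp [LinearEquiv.conjAlgEquiv_apply]

/-- The commutant of a splitting representation consists of the scalars. -/
theorem IsAzumaya.exists_smul_of_commute (hX : X.IsAzumaya) [Nontrivial V] [Module.Finite L V]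
    (ρ : X.carrier →ₐ[k] Module.End L V)
    (hV : Module.finrank L V ^ 2 = Module.finrank k X.carrier)
    (f : V →ₗ[L] V) (hf : ∀ x v, f (ρ x v) = ρ x (f v)) : ∃ l : L, ∀ v, f v = l • v := by
  -- The image of L ⊗ X is all of End_L(V), so commuting with X means being central.
  have hc : f ∈ Subalgebra.center L (Module.End L V) := by
    rw [Subalgebra.mem_center_iff]
    intro g
    obtain ⟨y, rfl⟩ := (hX.liftScalars_bijective ρ hV).2 g
    induction y with
    | zero => simp
    | add y z hy hz => rw [map_add, add_mul, mul_add, hy, hz]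
    | tmul l x =>
      ext v
      simp [liftScalars_tmul, hf]
  rw [Algebra.IsCentral.center_eq_bot, Algebra.mem_bot] at hc
  obtain ⟨l, rfl⟩ := hc
  exact ⟨l, fun v => rfl⟩

end Splitting

theorem finrank_tensor_opposite {A : AlgebraSheaf G k} :
    Module.finrank k A.carrier ^ 2 = Module.finrank k (A.tensor A.opposite).carrier := by
  change _ = Module.finrank k (A.carrier ⊗[k] A.carrierᵐᵒᵖ)
  rw [Module.finrank_tensorProduct,
    ← (MulOpposite.opLinearEquiv k : A.carrier ≃ₗ[k] A.carrierᵐᵒᵖ).finrank_eq, sq]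

/-- **Skolem–Noether**: automorphisms of an Azumaya algebra over a field are inner. -/
theorem IsAzumaya.exists_unit_conj {A : AlgebraSheaf G k} (hA : A.IsAzumaya)
    (σ : A.carrier ≃ₐ[k] A.carrier) :
    ∃ u : A.carrierˣ, ∀ a, σ a * u = u * a := by
  have := hA.finite
  have := hA.nontrivial
  let ρ : (A.tensor A.opposite).carrier →ₐ[k] Module.End k A.carrier :=
    AlgHom.mulLeftRight k A.carrier
  -- A ⊗ Aᵐᵒᵖ splits on A by two-sided multiplication, and also after twisting the left factor by σ.
  -- An intertwiner T is right A-linear, hence left multiplication by T(1), and the left factor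
  -- gives σ(a)T(1) = T(a) = T(1)a.
  let s : (A.tensor A.opposite).carrier →ₐ[k] (A.tensor A.opposite).carrier :=
    Algebra.TensorProduct.map σ.toAlgHom (AlgHom.id k A.carrierᵐᵒᵖ)
  obtain ⟨T, hT⟩ := (hA.tensor hA.opposite).exists_intertwiner (L := k) ρ (ρ.comp s)
    finrank_tensor_opposite finrank_tensor_opposite
  have hl : ∀ a b, T (a * b) = σ a * T b := fun a b => by
    have h := hT (a ⊗ₜ 1) b
    change T (AlgHom.mulLeftRight k A.carrier (a ⊗ₜ 1) b) =
      AlgHom.mulLeftRight k A.carrier (σ a ⊗ₜ 1) (T b) at h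
    simpa [AlgHom.mulLeftRight_apply] using h
  have hr : ∀ a b, T (a * b) = T a * b := fun a b => by
    have h := hT (1 ⊗ₜ MulOpposite.op b) a
    change T (AlgHom.mulLeftRight k A.carrier (1 ⊗ₜ MulOpposite.op b) a) =
      AlgHom.mulLeftRight k A.carrier (σ 1 ⊗ₜ MulOpposite.op b) (T a) at h
    simpa [AlgHom.mulLeftRight_apply] using h
  obtain ⟨v, hv⟩ := T.surjective 1
  have huv : T 1 * v = 1 := by rw [← hr, one_mul, hv]
  have hvu : σ v * T 1 = 1 := by rw [← hl, mul_one, hv]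
  refine ⟨⟨T 1, v, huv, ?_⟩, fun a => ?_⟩
  · rwa [left_inv_eq_right_inv hvu huv] at hvu
  · change σ a * T 1 = T 1 * a
    rw [← hl, ← hr, mul_one, one_mul]

theorem mul_mulLeftRight {A : Type u} [Ring A] [Algebra k A] (z : A) (hz : ∀ a, a * z = z * a)
    (x : A ⊗[k] Aᵐᵒᵖ) (v : A) :
    z * AlgHom.mulLeftRight k A x v = AlgHom.mulLeftRight k A x (z * v) := by
  induction x with
  | zero => simp
  | add x y hx hy => rw [map_add, LinearMap.add_apply, LinearMap.add_apply, mul_add, hx, hy]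
  | tmul a b => simp only [AlgHom.mulLeftRight_apply, ← mul_assoc, hz]

/-- Azumaya algebras over a field are central. -/
theorem IsAzumaya.exists_algebraMap {A : AlgebraSheaf G k} (hA : A.IsAzumaya) (z : A.carrier)
    (hz : ∀ a, a * z = z * a) : ∃ c : k, algebraMap k A.carrier c = z := by
  have := hA.finite
  have := hA.nontrivial
  let ρ : (A.tensor A.opposite).carrier →ₐ[k] Module.End k A.carrier :=
    AlgHom.mulLeftRight k A.carrier
  obtain ⟨c, hc⟩ := (hA.tensor hA.opposite).exists_smul_of_commute (L := k) ρ
    finrank_tensor_opposite (LinearMap.mulLeft k z) (mul_mulLeftRight z hz)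
  refine ⟨c, ?_⟩
  have := hc 1
  rw [LinearMap.mulLeft_apply, mul_one] at this
  rw [this, Algebra.algebraMap_eq_smul_one]

/-- An Azumaya algebra with an equivariant splitting representation has trivial class. -/
theorem IsAzumaya.brauerEquivalent_structureSheaf {X : AlgebraSheaf G k} (hX : X.IsAzumaya)
    (U : VectorBundle G k) (ρ : X.carrier →ₐ[k] Module.End k U.carrier)
    (hρ : ∀ g x v, U.act g (ρ x v) = ρ (X.act g x) (U.act g v))
    (hU : Module.finrank k U.carrier ^ 2 = Module.finrank k X.carrier) :
    BrauerEquivalent X (structureSheaf G k) := by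
  have hinj : Function.Injective ρ := hX.injective ρ
  have := hX.finite
  have hbij : Function.Bijective ρ := ⟨hinj,
    (LinearMap.injective_iff_surjective_of_finrank_eq_finrank (f := ρ.toLinearMap) (by
      rw [Module.finrank_linearMap, ← hU, sq])).1 hinj⟩
  let e : Iso X (endomorphisms U) :=
    ⟨AlgEquiv.ofBijective ρ hbij, fun g x => LinearMap.ext fun v => by
      change ρ (X.act g x) v = U.act g (ρ x ((U.act g).symm v))
      rw [hρ, LinearEquiv.apply_symm_apply]⟩
  exact ⟨.trivial G k, U, ⟨(e.tensorCongr endTrivial.symm).trans (Iso.tensorComm _ _)⟩⟩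

end AlgebraSheaf
end ClassifyingStack

/-! ### Twisted splittings and their tensor powers -/

namespace ClassifyingStack

variable {G k : Type u} [Group G] [Field k]

/-- An `L`-vector space with an `L`-linear descent datum and an `L`-linear equivariant action of a
sheaf of algebras `X` over `k` that splits `X` over `L`, together with a `σ`-semilinear operator
that commutes with `X`, commutes with the descent datum up to `η`, and has `e`-th power `c`. -/
structure TwistedSplitting (X : AlgebraSheaf G k) {L : Type u} [Field L] [Algebra k L]
    (σ : L ≃ₐ[k] L) (e : ℕ) (c : k) (η : G → k) where
  carrier : Type u
  [addCommGroup : AddCommGroup carrier]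
  [module : Module k carrier]
  [moduleL : Module L carrier]
  [isScalarTower : IsScalarTower k L carrier]
  [finite : Module.Finite L carrier]
  [nontrivial : Nontrivial carrier]
  rep : X.carrier →ₐ[k] Module.End L carrier
  finrank_sq : Module.finrank L carrier ^ 2 = Module.finrank k X.carrier
  act : G →* (carrier ≃ₗ[L] carrier)
  act_rep : ∀ g x v, act g (rep x v) = rep (X.act g x) (act g v)
  twist : carrier →ₛₗ[(σ : L →+* L)] carrier
  twist_rep : ∀ x v, twist (rep x v) = rep x (twist v)
  twist_act : ∀ g v, twist (act g v) = η g • act g (twist v)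
  twist_iterate : ∀ v, twist^[e] v = c • v

attribute [instance] TwistedSplitting.addCommGroup TwistedSplitting.module TwistedSplitting.moduleL
  TwistedSplitting.isScalarTower TwistedSplitting.finite TwistedSplitting.nontrivial

namespace TwistedSplitting

open AlgebraSheaf

variable {L : Type u} [Field L] [Algebra k L] {σ : L ≃ₐ[k] L} {e : ℕ}

/-- The unit for the tensor product of twisted splittings: L itself, with σ as the semilinear
operator. It starts the induction on tensor powers. -/
def ofStructureSheaf (hσ : σ ^ e = 1) :
    TwistedSplitting (structureSheaf G k) σ e 1 1 where
  carrier := L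
  rep := Algebra.ofId k (Module.End L L)
  finrank_sq := by
    change _ = Module.finrank k k
    simp
  act := 1
  act_rep _ _ _ := rfl
  twist := (σ : L →+* L).toSemilinearMap
  twist_rep x v := by
    exact map_smul σ (show k from x) v
  twist_act g v := by simp
  twist_iterate v := by
    have h : σ^[e] v = (σ ^ e) v := by
      rw [← AlgEquiv.coe_pow]
    rw [one_smul]
    exact h.trans (by rw [hσ]; rfl)

variable {X Y : AlgebraSheaf G k} {c d : k} {η θ : G → k}

/-- The action of a tensor product of algebras on the tensor product over `L`. -/
noncomputable def tensorRep {A B : Type u} [Ring A] [Ring B] [Algebra k A] [Algebra k B]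
    {V W : Type u} [AddCommGroup V] [Module k V] [Module L V] [IsScalarTower k L V]
    [AddCommGroup W] [Module k W] [Module L W] [IsScalarTower k L W]
    (ρ : A →ₐ[k] Module.End L V) (τ : B →ₐ[k] Module.End L W) :
    A ⊗[k] B →ₐ[k] Module.End L (V ⊗[L] W) :=
  Algebra.TensorProduct.lift
    (((Module.End.rTensorAlgHom L V W).restrictScalars k).comp ρ)
    (((Module.End.lTensorAlgHom L W V).restrictScalars k).comp τ) fun a b => by
      exact (LinearMap.rTensor_comp_lTensor _ (ρ a) (τ b)).trans
        (LinearMap.lTensor_comp_rTensor _ (ρ a) (τ b)).symm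

theorem tensorRep_tmul {A B : Type u} [Ring A] [Ring B] [Algebra k A] [Algebra k B]
    {V W : Type u} [AddCommGroup V] [Module k V] [Module L V] [IsScalarTower k L V]
    [AddCommGroup W] [Module k W] [Module L W] [IsScalarTower k L W]
    (ρ : A →ₐ[k] Module.End L V) (τ : B →ₐ[k] Module.End L W) (a : A) (b : B) :
    tensorRep ρ τ (a ⊗ₜ b) = TensorProduct.map (ρ a) (τ b) := by
  refine (Algebra.TensorProduct.lift_tmul _ _ _ _ _).trans ?_
  refine TensorProduct.ext' fun v w => ?_
  rfl


/-- The tensor product over `L` of twisted splittings. -/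
noncomputable def tensor (M : TwistedSplitting X σ e c η) (N : TwistedSplitting Y σ e d θ) :
    TwistedSplitting (X.tensor Y) σ e (c * d) (η * θ) where
  carrier := M.carrier ⊗[L] N.carrier
  rep := tensorRep M.rep N.rep
  finrank_sq := by
    refine (congrArg (· ^ 2) Module.finrank_tensorProduct).trans ?_
    rw [mul_pow, M.finrank_sq, N.finrank_sq]
    exact (Module.finrank_tensorProduct (R := k) (S := k)
      (M := X.carrier) (M' := Y.carrier)).symm
  act :=
    { toFun := fun g => TensorProduct.congr (M.act g) (N.act g)
      map_one' := by
        apply LinearEquiv.toLinearMap_injective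
        ext; simp
      map_mul' := fun g h => by
        apply LinearEquiv.toLinearMap_injective
        ext; simp }
  act_rep g x v := by
    have key : ∀ (x : X.carrier ⊗[k] Y.carrier) (v : M.carrier ⊗[L] N.carrier),
        TensorProduct.congr (M.act g) (N.act g) (tensorRep M.rep N.rep x v) =
          tensorRep M.rep N.rep (Algebra.TensorProduct.congr (X.act g) (Y.act g) x)
            (TensorProduct.congr (M.act g) (N.act g) v) := by
      intro x v
      induction x with
      | zero => simp
      | add x y hx hy => simp only [map_add, LinearMap.add_apply, hx, hy]
      | tmul a b =>
        induction v with
        | zero => simp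
        | add v w hv hw => simp only [map_add, hv, hw]
        | tmul v w => simp [tensorRep_tmul, M.act_rep, N.act_rep]
    exact key x v
  twist := TensorProduct.map M.twist N.twist
  twist_rep x v := by
    have key : ∀ (x : X.carrier ⊗[k] Y.carrier) (v : M.carrier ⊗[L] N.carrier),
        TensorProduct.map M.twist N.twist (tensorRep M.rep N.rep x v) =
          tensorRep M.rep N.rep x (TensorProduct.map M.twist N.twist v) := by
      intro x v
      induction x with
      | zero => simp
      | add x y hx hy => simp only [map_add, LinearMap.add_apply, hx, hy]
      | tmul a b =>
        induction v with
        | zero => simp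
        | add v w hv hw => simp only [map_add, hv, hw]
        | tmul v w => simp [tensorRep_tmul, M.twist_rep, N.twist_rep]
    exact key x v
  twist_act g v := by
    change TensorProduct.map M.twist N.twist (TensorProduct.congr (M.act g) (N.act g) v) =
      (η * θ) g • TensorProduct.congr (M.act g) (N.act g) (TensorProduct.map M.twist N.twist v)
    induction v with
    | zero => simp
    | add v w hv hw => simp only [map_add, smul_add, hv, hw]
    | tmul v w =>
      simp only [TensorProduct.congr_tmul, TensorProduct.map_tmul, M.twist_act, N.twist_act,
        Pi.mul_apply]
      rw [← algebraMap_smul L (η g), ← algebraMap_smul L (θ g), ← algebraMap_smul L (η g * θ g),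
        TensorProduct.smul_tmul_smul, map_mul]
  twist_iterate v := by
    have key : ∀ (j : ℕ) (v : M.carrier) (w : N.carrier),
        (TensorProduct.map M.twist N.twist)^[j] (v ⊗ₜ[L] w) =
          (M.twist^[j] v) ⊗ₜ[L] (N.twist^[j] w) := by
      intro j
      induction j with
      | zero => exact fun _ _ => rfl
      | succ j ih => exact fun v w => ih (M.twist v) (N.twist w)
    have hz : ∀ j : ℕ, (TensorProduct.map M.twist N.twist)^[j] 0 = 0 := fun j =>
      Function.iterate_fixed (map_zero _) j
    have ha : ∀ (j : ℕ) (v w : M.carrier ⊗[L] N.carrier),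
        (TensorProduct.map M.twist N.twist)^[j] (v + w) =
          (TensorProduct.map M.twist N.twist)^[j] v +
            (TensorProduct.map M.twist N.twist)^[j] w := by
      intro j
      induction j with
      | zero => exact fun _ _ => rfl
      | succ j ih =>
        intro v w
        simp only [Function.iterate_succ_apply, map_add, ih]
    induction v with
    | zero => rw [hz, smul_zero]
    | add v w hv hw => rw [ha, hv, hw, smul_add]
    | tmul v w =>
      rw [key, M.twist_iterate, N.twist_iterate, ← algebraMap_smul L c, ← algebraMap_smul L d,
        ← algebraMap_smul L (c * d), TensorProduct.smul_tmul_smul, map_mul]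

/-- Tensor powers raise both parameters to the same power. The case j = e is the useful one: c
becomes an e-th power, and η becomes trivial if its values are e-th roots of unity. -/
theorem exists_nsmul (hσ : σ ^ e = 1) (X : Azumaya G k)
    (M : TwistedSplitting X.toAlgebraSheaf σ e c η) (j : ℕ) :
    ∃ Z : Azumaya G k, Z.brauerClass = j • X.brauerClass ∧
      Nonempty (TwistedSplitting Z.toAlgebraSheaf σ e (c ^ j) (η ^ j)) := by
  induction j with
  | zero =>
    refine ⟨⟨structureSheaf G k, structureSheaf_isAzumaya⟩, (zero_nsmul _).symm, ⟨?_⟩⟩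
    rw [pow_zero, pow_zero]
    exact ofStructureSheaf hσ
  | succ j ih =>
    obtain ⟨Z, hZ, ⟨N⟩⟩ := ih
    refine ⟨⟨Z.tensor X.toAlgebraSheaf, Z.isAzumaya.tensor X.isAzumaya⟩, ?_, ⟨?_⟩⟩
    · rw [succ_nsmul, ← hZ]
      rfl
    · rw [pow_succ, pow_succ]
      exact N.tensor M

end TwistedSplitting
end ClassifyingStack

/-! ### Descent along a cyclic Kummer extension by eigenspaces -/

namespace ClassifyingStack

variable {G k : Type u} [Group G] [Field k]

theorem sum_finrank_le_of_iSupIndep {V : Type*} [AddCommGroup V] [Module k V] [Module.Finite k V]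
    {ι : Type*} [Fintype ι] (p : ι → Submodule k V) (hp : iSupIndep p) :
    ∑ i, Module.finrank k (p i) ≤ Module.finrank k V := by
  classical
  have h := LinearMap.finrank_le_finrank_of_injective hp.dfinsupp_lsum_injective
  exact (Module.finrank_directSum k fun i => p i).symm.trans_le h

section Descent

variable {L : Type u} [Field L] [Algebra k L] {σ : L ≃ₐ[k] L} {e : ℕ} {V : Type u}
  [AddCommGroup V] [Module k V] [Module L V] [IsScalarTower k L V]

/-- A semilinear map as a linear map over the fixed field. -/
def restrictScalarsSemilinear (ψ : V →ₛₗ[(σ : L →+* L)] V) : Module.End k V where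
  toFun := ψ
  map_add' := map_add ψ
  map_smul' r v := by
    rw [← algebraMap_smul L r v, map_smulₛₗ]
    simp

variable (ψ : V →ₛₗ[(σ : L →+* L)] V) {ζ : k} {t : L}

/-- Semilinearity gives ψ(t^i v) = ζ^i t^i ψ(v), so powers of t permute the eigenspaces. Negative
exponents are allowed so that any eigenvalue can be rotated back to c. -/
theorem smul_mem_eigenspace (ht : σ t = ζ • t) {μ : k} {v : V}
    (hv : v ∈ (restrictScalarsSemilinear ψ).eigenspace μ) (i : ℤ) :
    t ^ i • v ∈ (restrictScalarsSemilinear ψ).eigenspace (μ * ζ ^ i) := by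
  rw [Module.End.mem_eigenspace_iff] at hv ⊢
  change ψ v = μ • v at hv
  change ψ (t ^ i • v) = _
  rw [map_smulₛₗ, hv]
  have h : (σ : L →+* L) (t ^ i) = algebraMap k L (ζ ^ i) * t ^ i := by
    change σ (t ^ i) = _
    rw [map_zpow₀, ht, Algebra.smul_def, mul_zpow, map_zpow₀]
  rw [h, ← algebraMap_smul L μ, smul_smul, ← algebraMap_smul L (μ * _), smul_smul, map_mul]
  congr 1
  ring

/-- Descent along a cyclic Kummer extension: the fixed space of a normalized semilinear operator is
a form of the whole space. -/
theorem finrank_eigenspace_eq [FiniteDimensional k L] [Module.Finite L V] [Nontrivial V]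
    (he : 0 < e) (hL : Module.finrank k L = e)
    (hζ : IsPrimitiveRoot ζ e) (ht0 : t ≠ 0) (ht : σ t = ζ • t) {c : k} (hc : c ≠ 0)
    (hψ : ∀ v, ψ^[e] v = c ^ e • v) :
    0 < Module.finrank k ((restrictScalarsSemilinear ψ).eigenspace c) ∧
    Module.finrank k ((restrictScalarsSemilinear ψ).eigenspace c) ≤ Module.finrank L V := by
  have : Module.Finite k V := Module.Finite.trans L V
  set T := restrictScalarsSemilinear ψ with hT
  constructor
  · have hpow : T ^ e = algebraMap k _ (c ^ e) := by
      ext v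
      rw [Module.End.pow_apply]
      exact hψ v
    -- This polynomial splits over k because k contains ζ. Hence T has an eigenvalue, it has the
    -- form c ζ^i, and multiplication by t^(-i) moves its eigenvector into the c-eigenspace.
    have hdvd : minpoly k T ∣ Polynomial.X ^ e - Polynomial.C (c ^ e) := by
      apply minpoly.dvd
      simp [hpow]
    have hne := Polynomial.X_pow_sub_C_ne_zero he (c ^ e)
    have hsp := (X_pow_sub_C_splits_of_isPrimitiveRoot hζ (rfl : c ^ e = c ^ e)).of_dvd hne hdvd
    obtain ⟨μ, hμ⟩ := hsp.exists_eval_eq_zero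
      (minpoly.degree_pos (Algebra.IsIntegral.isIntegral T)).ne'
    have hμe : μ ^ e = c ^ e := by
      have := Polynomial.eval_eq_zero_of_dvd_of_eval_eq_zero hdvd hμ
      simpa [sub_eq_zero] using this
    have : NeZero e := ⟨he.ne'⟩
    obtain ⟨i, -, hi⟩ := hζ.eq_pow_of_pow_eq_one (ξ := μ / c) (by
      rw [div_pow, hμe, div_self (pow_ne_zero _ hc)])
    obtain ⟨v, hv⟩ := (Module.End.hasEigenvalue_of_isRoot hμ).exists_hasEigenvector
    have h := smul_mem_eigenspace ψ ht hv.1 (-i)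
    have hμc : μ * ζ ^ (-(i : ℤ)) = c := by
      rw [zpow_neg, zpow_natCast, hi]
      have : μ ≠ 0 := fun h0 => by
        rw [h0, zero_pow he.ne'] at hμe
        exact pow_ne_zero _ hc hμe.symm
      field_simp
    rw [hμc] at h
    have : Nontrivial (T.eigenspace c) :=
      ⟨⟨⟨_, h⟩, 0, fun h0 => smul_ne_zero (zpow_ne_zero _ ht0) hv.2 (congrArg Subtype.val h0)⟩⟩
    exact Module.finrank_pos
  -- The e eigenspaces for c ζ^i are independent, and each contains a copy t^i U of the c-eigenspace
  -- U. So e · dim_k U ≤ dim_k V = e · dim_L V.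
  · have hind : iSupIndep fun i : Fin e => T.eigenspace (c * ζ ^ (i : ℤ)) := by
      refine (Module.End.eigenspaces_iSupIndep T).comp (f := fun i : Fin e => c * ζ ^ (i : ℤ)) ?_
      intro i j hij
      have := mul_left_cancel₀ hc hij
      simp only [zpow_natCast] at this
      exact Fin.ext (hζ.pow_inj i.2 j.2 this)
    have h1 := sum_finrank_le_of_iSupIndep _ hind
    have h2 : ∀ i : Fin e, Module.finrank k (T.eigenspace c) ≤
        Module.finrank k (T.eigenspace (c * ζ ^ (i : ℤ))) := fun i =>
      LinearMap.finrank_le_finrank_of_injective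
        (f := LinearMap.restrict (DistribSMul.toLinearMap k V (t ^ (i : ℤ)))
          fun v hv => smul_mem_eigenspace ψ ht hv i) (by
        intro v w hvw
        have := congrArg Subtype.val hvw
        exact Subtype.ext (smul_right_injective V (zpow_ne_zero _ ht0) this))
    have h3 := (Finset.sum_le_sum fun i _ => h2 i).trans h1
    rw [Finset.sum_const, Finset.card_univ, Fintype.card_fin, smul_eq_mul,
      ← Module.finrank_mul_finrank k L V, hL] at h3
    exact Nat.le_of_mul_le_mul_left h3 he

end Descent

open AlgebraSheaf

/-- A twisted splitting whose operator can be normalized to commute with the descent datum and to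
have trivial `e`-th power descends to an equivariant splitting. -/
theorem TwistedSplitting.brauerEquivalent_structureSheaf {L : Type u} [Field L] [Algebra k L]
    [FiniteDimensional k L] {σ : L ≃ₐ[k] L} {e : ℕ} {X : AlgebraSheaf G k} (hX : X.IsAzumaya)
    {c : k} {η : G → k} (M : TwistedSplitting X σ e (c ^ e) η) (hη : ∀ g, η g = 1) (hc : c ≠ 0)
    (he : 0 < e) (hL : Module.finrank k L = e) {ζ : k} {t : L}
    (hζ : IsPrimitiveRoot ζ e) (ht0 : t ≠ 0) (ht : σ t = ζ • t) :
    BrauerEquivalent X (structureSheaf G k) := by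
  obtain ⟨hpos, hle⟩ := finrank_eigenspace_eq M.twist he hL hζ ht0 ht hc M.twist_iterate
  have : Module.Finite k M.carrier := Module.Finite.trans L M.carrier
  set U := (restrictScalarsSemilinear M.twist).eigenspace c
  have hU : ∀ v, v ∈ U ↔ M.twist v = c • v := fun v => Module.End.mem_eigenspace_iff
  have : Nontrivial U := Module.nontrivial_of_finrank_pos hpos
  have hact : ∀ g, ∀ v ∈ U, M.act g v ∈ U := fun g v hv => by
    rw [hU] at hv ⊢
    rw [M.twist_act, hη, one_smul, hv, ← algebraMap_smul L c, ← algebraMap_smul L c, map_smul]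
  have hrep : ∀ x, ∀ v ∈ U, M.rep x v ∈ U := fun x v hv => by
    rw [hU] at hv ⊢
    rw [M.twist_rep, hv, ← algebraMap_smul L c, ← algebraMap_smul L c, map_smul]
  let actHom : G →* Module.End k U :=
    { toFun := fun g => ((M.act g).toLinearMap.restrictScalars k).restrict (hact g)
      map_one' := by ext v; simp
      map_mul' := fun g h => by ext v; simp; rfl }
  let E : VectorBundle G k :=
    { carrier := U
      act := (LinearMap.GeneralLinearGroup.generalLinearEquiv k U).toMonoidHom.comp
        actHom.toHomUnits }
  let ρ : X.carrier →ₐ[k] Module.End k U :=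
    { toFun := fun x => ((M.rep x).restrictScalars k).restrict (hrep x)
      map_one' := by ext v; simp
      map_mul' := fun x y => by ext v; simp; rfl
      map_zero' := by ext v; simp
      map_add' := fun x y => by ext v; simp; rfl
      commutes' := fun r => by ext v; simp }
  -- U is nonzero, so X embeds in End_k(U). This bounds dim U from below by dim_L of the splitting,
  -- the inequality that eigenspace counting does not give.
  have hinj : Function.Injective ρ := hX.injective ρ
  have h1 := LinearMap.finrank_le_finrank_of_injective (f := ρ.toLinearMap) hinj
  rw [Module.finrank_linearMap, ← M.finrank_sq, ← sq] at h1
  have h2 : Module.finrank k U = Module.finrank L M.carrier :=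
    le_antisymm hle ((Nat.pow_le_pow_iff_left two_ne_zero).1 h1)
  refine hX.brauerEquivalent_structureSheaf E ρ (fun g x v => Subtype.ext ?_) ?_
  · exact M.act_rep g x v
  · rw [← M.finrank_sq, ← h2]

end ClassifyingStack

/-! ### Lifting a Galois automorphism to a semilinear operator -/

namespace ClassifyingStack

variable {G k : Type u} [Group G] [Field k]

section SemilinearTwist

variable {L : Type u} [Field L] [Algebra k L]

/-- The vector space `V` with scalar multiplication twisted by `σ`. -/
def SemilinearTwist (_ : L ≃ₐ[k] L) (V : Type u) : Type u := V

variable (σ : L ≃ₐ[k] L) (V : Type u) [AddCommGroup V] [Module k V] [Module L V]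
  [IsScalarTower k L V]

instance : AddCommGroup (SemilinearTwist σ V) := inferInstanceAs (AddCommGroup V)
instance : Module k (SemilinearTwist σ V) := inferInstanceAs (Module k V)
instance : Module L (SemilinearTwist σ V) := Module.compHom V (σ : L →+* L)

instance : IsScalarTower k L (SemilinearTwist σ V) where
  smul_assoc r l v := by
    change σ (r • l) • (show V from v) = r • (σ l • (show V from v))
    rw [map_smul, smul_assoc]

/-- The twist does not change the k-structure, and the k-dimension is [L:k] times the L-dimension.
-/
theorem SemilinearTwist.finrank_eq [FiniteDimensional k L] :
    Module.finrank L (SemilinearTwist σ V) = Module.finrank L V := by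
  have h1 := Module.finrank_mul_finrank k L (SemilinearTwist σ V)
  have h2 := Module.finrank_mul_finrank k L V
  exact Nat.eq_of_mul_eq_mul_left (Module.finrank_pos (R := k) (M := L)) (h1.trans h2.symm)

end SemilinearTwist

open AlgebraSheaf

section Twist

variable {L : Type u} [Field L] [Algebra k L] [FiniteDimensional k L] {X : AlgebraSheaf G k}
  {V : Type u} [AddCommGroup V] [Module k V] [Module L V] [IsScalarTower k L V]
  [Module.Finite L V] [Nontrivial V]

/-- The same operators of X split X on V with scalars twisted by σ. An L-linear intertwiner from V
to its twist is a σ-semilinear automorphism of V commuting with X. -/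
theorem AlgebraSheaf.IsAzumaya.exists_semilinear (hX : X.IsAzumaya)
    (ρ : X.carrier →ₐ[k] Module.End L V)
    (hV : Module.finrank L V ^ 2 = Module.finrank k X.carrier) (σ : L ≃ₐ[k] L) :
    ∃ ψ : V ≃+ V, (∀ (l : L) v, ψ (l • v) = σ l • ψ v) ∧ ∀ x v, ψ (ρ x v) = ρ x (ψ v) := by
  have : Nontrivial (SemilinearTwist σ V) := inferInstanceAs (Nontrivial V)
  have : Module.Finite k V := Module.Finite.trans L V
  have : Module.Finite k (SemilinearTwist σ V) := inferInstanceAs (Module.Finite k V)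
  have : Module.Finite L (SemilinearTwist σ V) := Module.Finite.of_restrictScalars_finite k L _
  let τ : X.carrier →ₐ[k] Module.End L (SemilinearTwist σ V) :=
    { toFun := fun x =>
        { toFun := fun v => ρ x v
          map_add' := map_add (ρ x)
          map_smul' := fun l v => (ρ x).map_smul (σ l) v }
      map_one' := by
        refine LinearMap.ext fun v => ?_
        exact DFunLike.congr_fun (map_one ρ) v
      map_mul' := fun x y => by
        refine LinearMap.ext fun v => ?_
        exact DFunLike.congr_fun (map_mul ρ x y) v
      map_zero' := by
        refine LinearMap.ext fun v => ?_
        exact DFunLike.congr_fun (map_zero ρ) v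
      map_add' := fun x y => by
        refine LinearMap.ext fun v => ?_
        exact DFunLike.congr_fun (map_add ρ x y) v
      commutes' := fun r => by
        refine LinearMap.ext fun v => ?_
        exact DFunLike.congr_fun (AlgHom.commutes ρ r) v }
  obtain ⟨T, hT⟩ := hX.exists_intertwiner ρ τ hV (by rw [SemilinearTwist.finrank_eq, hV])
  exact ⟨T.toAddEquiv, fun l v => map_smul T l v, hT⟩

/-- An equivariant splitting over a cyclic extension can be completed to a twisted splitting. -/
theorem AlgebraSheaf.IsAzumaya.exists_twistedSplitting (hX : X.IsAzumaya)
    (ρ : X.carrier →ₐ[k] Module.End L V)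
    (hV : Module.finrank L V ^ 2 = Module.finrank k X.carrier)
    (act : G →* (V ≃ₗ[L] V)) (hact : ∀ g x v, act g (ρ x v) = ρ (X.act g x) (act g v))
    (σ : L ≃ₐ[k] L) {e : ℕ} (hσ : σ ^ e = 1)
    (hfix : ∀ l, σ l = l → ∃ r : k, algebraMap k L r = l) {n : ℕ}
    (hG : ∀ g : G, g ^ n = 1) (hroots : ∀ l : L, l ^ n = 1 → ∃ r : k, algebraMap k L r = l) :
    ∃ (c : k) (η : G → k), c ≠ 0 ∧ η ^ e = 1 ∧ Nonempty (TwistedSplitting X σ e c η) := by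
  obtain ⟨ψ, hψl, hψx⟩ := hX.exists_semilinear ρ hV σ
  obtain ⟨v₀, hv₀⟩ := exists_ne (0 : V)
  have hψ0 : ∀ v, v ≠ 0 → ψ v ≠ 0 := fun v hv h => hv (ψ.injective (h.trans (map_zero ψ).symm))
  have hcancel : ∀ (l l' : L) (v : V), v ≠ 0 → l • v = l' • v → l = l' := fun l l' v hv h =>
    smul_left_injective L hv h
  -- the power of the operator
  have hpl : ∀ (j : ℕ) (l : L) v, ψ^[j] (l • v) = (σ ^ j) l • ψ^[j] v := by
    intro j
    induction j with
    | zero => exact fun _ _ => rfl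
    | succ j ih => intro l v; rw [Function.iterate_succ_apply, hψl, ih, pow_succ]; rfl
  have hpx : ∀ (j : ℕ) x v, ψ^[j] (ρ x v) = ρ x (ψ^[j] v) := by
    intro j
    induction j with
    | zero => exact fun _ _ => rfl
    | succ j ih => intro x v; rw [Function.iterate_succ_apply, hψx, ih]; rfl
  have hpa : ∀ (j : ℕ) v w, ψ^[j] (v + w) = ψ^[j] v + ψ^[j] w := by
    intro j
    induction j with
    | zero => exact fun _ _ => rfl
    | succ j ih => intro v w; simp only [Function.iterate_succ_apply, map_add, ih]
  -- As σ^e = 1, the operator ψ^e is L-linear and commutes with X, so it is a scalar. It also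
  -- commutes with ψ, so the scalar is fixed by σ and lies in k.
  obtain ⟨l, hl⟩ := hX.exists_smul_of_commute ρ hV
    { toFun := ψ^[e], map_add' := hpa e, map_smul' := fun l v => by rw [hpl, hσ]; rfl } (hpx e)
  replace hl : ∀ v, ψ^[e] v = l • v := hl
  obtain ⟨c, rfl⟩ := hfix l (by
    refine hcancel _ _ (ψ v₀) (hψ0 v₀ hv₀) ?_
    rw [← hψl, ← hl, ← hl, ← Function.iterate_succ_apply, Function.iterate_succ_apply'])
  have hc : c ≠ 0 := by
    rintro rfl
    have h1 : ψ^[e] v₀ = ψ^[e] 0 := by rw [hl, hl, map_zero, zero_smul, zero_smul]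
    exact hv₀ (ψ.injective.iterate e h1)
  -- the commutator with the descent datum
  have hη : ∀ g, ∃ l : L, ∀ v, ψ (act g v) = l • act g (ψ v) := by
    intro g
    -- The commutator of ψ with the action of g is L-linear. It commutes with X because ψ does and
    -- the action of g is equivariant.
    obtain ⟨l, hl⟩ := hX.exists_smul_of_commute ρ hV
      { toFun := fun v => ψ.symm ((act g).symm (ψ (act g v)))
        map_add' := fun v w => by simp only [map_add]
        map_smul' := fun l v => ψ.injective <| by
          simp only [map_smul, hψl, AddEquiv.apply_symm_apply, RingHom.id_apply] } (by
        intro x v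
        apply ψ.injective
        apply (act g).injective
        simp only [LinearMap.coe_mk, AddHom.coe_mk]
        rw [hψx, hact, hact, AddEquiv.apply_symm_apply, AddEquiv.apply_symm_apply,
          LinearEquiv.apply_symm_apply, LinearEquiv.apply_symm_apply, hψx])
    refine ⟨σ l, fun v => ?_⟩
    have h := hl v
    simp only [LinearMap.coe_mk, AddHom.coe_mk] at h
    rw [AddEquiv.symm_apply_eq, LinearEquiv.symm_apply_eq] at h
    rw [h, hψl, map_smul]
  choose η hη using hη
  have hpow : ∀ g (j : ℕ) v, ψ (act (g ^ j) v) = η g ^ j • act (g ^ j) (ψ v) := by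
    intro g j
    induction j with
    | zero => intro v; simp
    | succ j ih =>
      intro v
      have h1 : ∀ w, act (g ^ (j + 1)) w = act (g ^ j) (act g w) := fun w => by
        rw [pow_succ, map_mul]; rfl
      rw [h1, h1, ih, hη, map_smul, smul_smul, pow_succ]
  -- ψ commutes with the action of g^n = 1, so η(g) is an n-th root of unity and therefore lies in
  -- k.
  have hηn : ∀ g, η g ^ n = 1 := fun g => by
    have h := hpow g n v₀
    rw [hG, map_one] at h
    refine hcancel _ _ (ψ v₀) (hψ0 v₀ hv₀) ?_
    rw [one_smul]
    exact h.symm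
  choose z hz using fun g => hroots (η g) (hηn g)
  -- Since η(g) lies in k, ψ^e commutes with g up to η(g)^e; but ψ^e is the scalar c, which commutes
  -- with g exactly.
  have hze : ∀ g, z g ^ e = 1 := fun g => by
    have h1 : ∀ (j : ℕ) v, ψ^[j] (act g v) = z g ^ j • act g (ψ^[j] v) := by
      intro j
      induction j with
      | zero => intro v; simp
      | succ j ih =>
        intro v
        rw [Function.iterate_succ_apply', ih, Function.iterate_succ_apply', ← algebraMap_smul L,
          hψl, hη, AlgEquiv.commutes, ← hz, smul_smul, ← map_mul, algebraMap_smul, pow_succ]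
    have h2 := h1 e v₀
    rw [hl, hl, map_smul, ← algebraMap_smul L (z g ^ e), smul_smul, ← map_mul] at h2
    have h3 := (algebraMap k L).injective (hcancel _ _ _
      (fun h => hv₀ ((act g).injective (h.trans (map_zero (act g)).symm))) h2)
    exact (mul_right_cancel₀ hc (by rw [one_mul]; exact h3)).symm
  refine ⟨c, z, hc, funext hze, ⟨?_⟩⟩
  exact
    { carrier := V
      rep := ρ
      finrank_sq := hV
      act := act
      act_rep := hact
      twist := { toFun := ψ, map_add' := map_add ψ, map_smul' := hψl }
      twist_rep := hψx
      twist_act := fun g v => by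
        rw [← algebraMap_smul L, hz]
        exact hη g v
      twist_iterate := fun v => by
        rw [← algebraMap_smul L]
        exact hl v }

/-- The multiple of the class of `X` by the degree of a cyclic Kummer extension that splits `X`
equivariantly is trivial. -/
theorem Azumaya.nsmul_brauerClass_eq_zero (X : Azumaya G k)
    (ρ : X.carrier →ₐ[k] Module.End L V)
    (hV : Module.finrank L V ^ 2 = Module.finrank k X.carrier)
    (act : G →* (V ≃ₗ[L] V)) (hact : ∀ g x v, act g (ρ x v) = ρ (X.act g x) (act g v))
    (σ : L ≃ₐ[k] L) {e : ℕ} (he : 0 < e) (hL : Module.finrank k L = e) (hσ : σ ^ e = 1)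
    (hfix : ∀ l, σ l = l → ∃ r : k, algebraMap k L r = l) {n : ℕ}
    (hG : ∀ g : G, g ^ n = 1) (hroots : ∀ l : L, l ^ n = 1 → ∃ r : k, algebraMap k L r = l)
    {ζ : k} {t : L} (hζ : IsPrimitiveRoot ζ e) (ht0 : t ≠ 0) (ht : σ t = ζ • t) :
    e • X.brauerClass = 0 := by
  obtain ⟨c, η, hc, hη, ⟨M⟩⟩ :=
    X.isAzumaya.exists_twistedSplitting ρ hV act hact σ hσ hfix hG hroots
  -- The e-th tensor power has parameters c^e and η^e = 1, precisely what descent requires.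
  obtain ⟨Z, hZ, ⟨N⟩⟩ := TwistedSplitting.exists_nsmul hσ X M e
  rw [← hZ]
  exact Quotient.sound (N.brauerEquivalent_structureSheaf Z.isAzumaya
    (fun g => congrFun hη g) hc he hL hζ ht0 ht)

end Twist
end ClassifyingStack

/-! ### Simple modules: the central operator t and the double centralizer -/

namespace ClassifyingStack

variable {G k : Type u} [Group G] [Field k]

theorem finrank_linearMap_divisionRing (k D V W : Type u) [Field k] [DivisionRing D] [Algebra k D]
    [AddCommGroup V] [Module D V] [Module.Finite D V]
    [AddCommGroup W] [Module k W] [Module.Finite k W] [Module D W] [IsScalarTower k D W] :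
    Module.finrank k (V →ₗ[D] W) = Module.finrank D V * Module.finrank k W := by
  have : SMulCommClass D k W := IsScalarTower.to_smulCommClass'
  rw [← ((Module.finBasis D V).constr k (M' := W)).finrank_eq, Module.finrank_pi_fintype]
  simp

open AlgebraSheaf

variable {A : AlgebraSheaf G k}

/-- `M` is a simple object of `Coh(BG, A)` and `D` is its endomorphism algebra. -/
structure IsSimpleWithEnd (M : CohMod A) (D : Type u) [DivisionRing D] [Module D M.carrier] :
    Prop where
  nontrivial : Nontrivial M.carrier
  eq_bot_or_eq_top : ∀ N : Submodule k M.carrier,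
    (∀ (a : A.carrier), ∀ x ∈ N, MulOpposite.op a • x ∈ N) → (∀ g, ∀ x ∈ N, M.act g x ∈ N) →
      N = ⊥ ∨ N = ⊤
  smul_op : ∀ (d : D) (a : A.carrier) (x : M.carrier),
    d • MulOpposite.op a • x = MulOpposite.op a • d • x
  act_smul : ∀ (g : G) (d : D) (x : M.carrier), M.act g (d • x) = d • M.act g x
  exists_smul : ∀ f ∈ CohMod.homs M M, ∃ d : D, ∀ x, f x = d • x

section Generator

variable {g : G} {n : ℕ}

/-- The descent datum on an Azumaya algebra is conjugation by the powers of a unit. -/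
theorem AlgebraSheaf.IsAzumaya.exists_unit_act (hA : A.IsAzumaya) (hgn : g ^ n = 1) :
    ∃ (u : A.carrierˣ) (a : k), (∀ (j : ℕ) b, A.act (g ^ j) b * (u ^ j : A.carrierˣ) =
      (u ^ j : A.carrierˣ) * b) ∧ A.act g u = u ∧ ((u ^ n : A.carrierˣ) : A.carrier) =
        algebraMap k A.carrier a ∧ a ≠ 0 := by
  have := hA.nontrivial
  obtain ⟨u, hu⟩ := hA.exists_unit_conj (A.act g)
  have hj : ∀ (j : ℕ) b, A.act (g ^ j) b * (u ^ j : A.carrierˣ) = (u ^ j : A.carrierˣ) * b := by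
    intro j
    induction j with
    | zero => intro b; simp
    | succ j ih =>
      intro b
      have h : A.act (g ^ (j + 1)) b = A.act (g ^ j) (A.act g b) := by
        rw [pow_succ, map_mul]; rfl
      rw [h, pow_succ, Units.val_mul, ← mul_assoc, ih, mul_assoc, hu, mul_assoc]
  -- Conjugation by u^n is the action of g^n = 1, so u^n is central.
  obtain ⟨a, ha⟩ := hA.exists_algebraMap ((u ^ n : A.carrierˣ) : A.carrier) fun b => by
    have h := hj n b
    rw [hgn, map_one] at h
    exact h
  refine ⟨u, a, hj, u.isUnit.mul_right_cancel (hu u), ha.symm, ?_⟩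
  rintro rfl
  rw [map_zero] at ha
  exact (u ^ n).ne_zero ha.symm

theorem act_pow_eq {u : A.carrier} (hgu : A.act g u = u) (j : ℕ) : A.act (g ^ j) u = u := by
  induction j with
  | zero => simp
  | succ j ih =>
    rw [pow_succ, map_mul]
    change A.act (g ^ j) (A.act g u) = u
    rw [hgu, ih]

variable {M : CohMod A} {D L : Type u} [DivisionRing D] [Field L] [Algebra L D]
  [Algebra.IsCentral L D] [Module D M.carrier] [Module L M.carrier] [IsScalarTower L D M.carrier]

/-- The twist by u makes g linear over A: g(xa)u = (gx)(ga)u = (gx)ua. Since u is fixed by the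
generator g, the operator also respects the descent datum, so it lies in D. It commutes with D, so
it is in the centre L. -/
theorem IsSimpleWithEnd.exists_smul_eq (hM : IsSimpleWithEnd M D) {u : A.carrier}
    (hu : ∀ b, A.act g b * u = u * b) (hgu : A.act g u = u) (hg : ∀ h : G, ∃ j : ℕ, g ^ j = h) :
    ∃ t : L, ∀ x : M.carrier, t • x = MulOpposite.op u • M.act g x := by
  have hmul : ∀ (a b : A.carrier) (x : M.carrier), MulOpposite.op (a * b) • x =
      MulOpposite.op b • MulOpposite.op a • x := fun a b x => by
    rw [MulOpposite.op_mul, mul_smul]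
  have : SMulCommClass k A.carrierᵐᵒᵖ M.carrier := IsScalarTower.to_smulCommClass
  let f : M.carrier →ₗ[k] M.carrier :=
    { toFun := fun x => MulOpposite.op u • M.act g x
      map_add' := fun x y => by rw [map_add, smul_add]
      map_smul' := fun r x => by rw [map_smul, RingHom.id_apply, smul_comm] }
  obtain ⟨d, hd⟩ := hM.exists_smul f ⟨fun a x => by
      change MulOpposite.op u • M.act g (MulOpposite.op a • x) =
        MulOpposite.op a • MulOpposite.op u • M.act g x
      rw [M.act_smul, ← hmul, ← hmul, hu], fun h x => by
      change MulOpposite.op u • M.act g (M.act h x) = M.act h (MulOpposite.op u • M.act g x)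
      obtain ⟨j, rfl⟩ := hg h
      have h2 : M.act g (M.act (g ^ j) x) = M.act (g ^ j) (M.act g x) := by
        change (M.act g * M.act (g ^ j)) x = (M.act (g ^ j) * M.act g) x
        rw [← map_mul, ← map_mul, ← pow_succ, ← pow_succ']
      rw [M.act_smul, act_pow_eq hgu, h2]⟩
  have := hM.nontrivial
  obtain ⟨x₀, hx₀⟩ := exists_ne (0 : M.carrier)
  have hc : d ∈ Subalgebra.center L D := by
    rw [Subalgebra.mem_center_iff]
    intro d'
    refine smul_left_injective D hx₀ ?_
    change (d' * d) • x₀ = (d * d') • x₀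
    rw [mul_smul, mul_smul, ← hd, ← hd]
    change d' • MulOpposite.op u • M.act g x₀ = MulOpposite.op u • M.act g (d' • x₀)
    rw [hM.smul_op, hM.act_smul]
  rw [Algebra.IsCentral.center_eq_bot, Algebra.mem_bot] at hc
  obtain ⟨t, rfl⟩ := hc
  refine ⟨t, fun x => ?_⟩
  rw [← algebraMap_smul D t x]
  exact (hd x).symm

theorem IsSimpleWithEnd.smul_pow_eq {u : A.carrier} (hgu : A.act g u = u)
    {t : L} (ht : ∀ x : M.carrier, t • x = MulOpposite.op u • M.act g x) (j : ℕ) (x : M.carrier) :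
    t ^ j • x = MulOpposite.op (u ^ j) • M.act (g ^ j) x := by
  induction j generalizing x with
  | zero => simp
  | succ j ih =>
    rw [pow_succ, mul_smul, ht, ih, M.act_smul, act_pow_eq hgu, smul_smul, ← MulOpposite.op_mul, ← pow_succ',
      pow_succ g, map_mul]
    rfl

/-- The power t^n acts as u^n combined with g^n = 1, that is, as the scalar a. This makes t a Kummer
element. -/
theorem IsSimpleWithEnd.exists_pow_eq [Algebra k L] [IsScalarTower k L M.carrier]
    (hA : A.IsAzumaya) (hM : IsSimpleWithEnd M D) (hgn : g ^ n = 1) (hn : n ≠ 0)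
    (hg : ∀ h : G, ∃ j : ℕ, g ^ j = h) :
    ∃ (u : A.carrierˣ) (a : k) (t : L), (∀ b, A.act g b * u = u * b) ∧
      ((u ^ n : A.carrierˣ) : A.carrier) = algebraMap k A.carrier a ∧ t ^ n = algebraMap k L a ∧
      t ≠ 0 ∧ ∀ x : M.carrier, t • x = MulOpposite.op (u : A.carrier) • M.act g x := by
  obtain ⟨u, a, hu, hgu, ha, ha0⟩ := hA.exists_unit_act hgn
  have hu1 : ∀ b, A.act g b * u = u * b := fun b => by simpa using hu 1 b
  obtain ⟨t, ht⟩ := hM.exists_smul_eq (L := L) hu1 hgu hg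
  have htn : t ^ n = algebraMap k L a := by
    have := hM.nontrivial
    obtain ⟨x₀, hx₀⟩ := exists_ne (0 : M.carrier)
    refine smul_left_injective L hx₀ ?_
    change t ^ n • x₀ = algebraMap k L a • x₀
    rw [smul_pow_eq hgu ht, ← Units.val_pow_eq_pow_val, ha, hgn, map_one, algebraMap_smul]
    exact algebraMap_smul A.carrierᵐᵒᵖ a x₀
  refine ⟨u, a, t, hu1, ha, htn, ?_, ht⟩
  rintro rfl
  rw [zero_pow hn] at htn
  exact ha0 ((map_eq_zero (algebraMap k L)).1 htn.symm)

end Generator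

section DoubleCentralizer

variable {M : CohMod A} {D K : Type u} [DivisionRing D] [Module D M.carrier] [Field K] [Algebra k K]
  [Algebra k D] [IsScalarTower k D M.carrier]
  [Algebra K D] [Module K M.carrier] [IsScalarTower K D M.carrier] [IsScalarTower k K M.carrier]

/-- The action of `K ⊗ Aᵐᵒᵖ` on `M` by `D`-linear maps. -/
noncomputable def IsSimpleWithEnd.rep (hM : IsSimpleWithEnd M D) :
    A.carrierᵐᵒᵖ →ₐ[k] Module.End D M.carrier :=
  have : SMulCommClass D k M.carrier := IsScalarTower.to_smulCommClass'
  { toFun := fun a =>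
      { toFun := fun x => a • x
        map_add' := smul_add a
        map_smul' := fun d x => (hM.smul_op d a.unop x).symm }
    map_one' := by ext x; exact one_smul _ x
    map_mul' := fun a b => by ext x; exact mul_smul a b x
    map_zero' := by ext x; exact zero_smul _ x
    map_add' := fun a b => by ext x; exact add_smul a b x
    commutes' := fun r => by ext x; exact algebraMap_smul A.carrierᵐᵒᵖ r x }

/-- The action of `K ⊗ Aᵐᵒᵖ` on `M` by `D`-linear maps. -/
noncomputable def IsSimpleWithEnd.repTensor (hM : IsSimpleWithEnd M D) :
    K ⊗[k] A.carrierᵐᵒᵖ →ₐ[K] Module.End D M.carrier :=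
  Algebra.TensorProduct.lift (Algebra.ofId K (Module.End D M.carrier)) hM.rep
    fun l x => Algebra.commutes l (hM.rep x)

theorem IsSimpleWithEnd.repTensor_tmul (hM : IsSimpleWithEnd M D) (l : K) (a : A.carrierᵐᵒᵖ)
    (x : M.carrier) : hM.repTensor (l ⊗ₜ a) x = l • a • x :=
  DFunLike.congr_fun (Algebra.TensorProduct.lift_tmul _ _ _ l a) x

theorem IsSimpleWithEnd.repTensor_injective (hA : A.IsAzumaya) (hM : IsSimpleWithEnd M D) :
    Function.Injective (hM.repTensor (K := K)) := by
  have := hM.nontrivial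
  exact (hA.opposite.extendScalars K).injective (C := Module.End D M.carrier) hM.repTensor

variable {g : G}

/-- The action of g is t followed by u⁻¹, so it comes from K ⊗ Aᵐᵒᵖ. Hence M is simple over this
ring with endomorphisms in D, and the density theorem applies. The field K is left free so that both
the centre L and its subfield k(t) can be used. -/
theorem IsSimpleWithEnd.repTensor_surjective (hM : IsSimpleWithEnd M D)
    {u : A.carrierˣ} {t : K}
    (ht : ∀ x : M.carrier, t • x = MulOpposite.op (u : A.carrier) • M.act g x)
    (hg : ∀ h : G, ∃ j : ℕ, g ^ j = h) : Function.Surjective (hM.repTensor (K := K)) := by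
  have := hM.nontrivial
  let R := K ⊗[k] A.carrierᵐᵒᵖ
  let _ : Module R M.carrier := Module.compHom M.carrier (hM.repTensor (K := K)).toRingHom
  have hR : ∀ (l : K) (a : A.carrierᵐᵒᵖ) (x : M.carrier), (l ⊗ₜ[k] a : R) • x = l • a • x :=
    hM.repTensor_tmul
  have hop : ∀ (a : A.carrierᵐᵒᵖ) (x : M.carrier), (1 ⊗ₜ[k] a : R) • x = a • x := fun a x => by
    rw [hR, one_smul]
  have hK : ∀ (l : K) (x : M.carrier), (l ⊗ₜ[k] 1 : R) • x = l • x := fun l x => by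
    rw [hR, one_smul]
  have hact : ∀ x, M.act g x = MulOpposite.op ((u⁻¹ : A.carrierˣ) : A.carrier) • t • x :=
    fun x => by
      rw [ht, smul_smul, ← MulOpposite.op_mul, Units.mul_inv, MulOpposite.op_one, one_smul]
  have hsimple : IsSimpleModule R M.carrier := by
    rw [isSimpleModule_iff]
    refine { exists_pair_ne := ⟨⊥, ⊤, bot_ne_top⟩, eq_bot_or_eq_top := fun N => ?_ }
    let N' : Submodule k M.carrier :=
      { carrier := N
        add_mem' := N.add_mem
        zero_mem' := N.zero_mem
        smul_mem' := fun c x hx => by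
          have h := N.smul_mem (algebraMap k K c ⊗ₜ[k] 1 : R) hx
          rwa [hK, algebraMap_smul] at h }
    have hN1 : ∀ x ∈ N', M.act g x ∈ N' := fun x hx => by
      rw [hact, ← hop, ← hK]
      exact N.smul_mem _ (N.smul_mem _ hx)
    have hN : N' = ⊥ ∨ N' = ⊤ := hM.eq_bot_or_eq_top N' (fun a x hx => by
      rw [← hop]
      exact N.smul_mem _ hx) fun h x hx => by
        obtain ⟨j, rfl⟩ := hg h
        induction j generalizing x with
        | zero => simpa using hx
        | succ j ih =>
          rw [pow_succ, map_mul]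
          exact ih _ (hN1 x hx)
    rcases hN with h | h
    · left
      ext x
      exact (SetLike.ext_iff.1 h x)
    · right
      ext x
      exact (SetLike.ext_iff.1 h x)
  intro f
  have hend : ∀ φ : Module.End R M.carrier, ∃ d : D, ∀ x, φ x = d • x := fun φ => by
    let φ' : M.carrier →ₗ[k] M.carrier :=
      { toFun := φ
        map_add' := map_add φ
        map_smul' := fun c x => by
          rw [← algebraMap_smul K c x, ← hK, map_smul, hK, algebraMap_smul, RingHom.id_apply] }
    refine hM.exists_smul φ' ⟨fun a x => ?_, fun h x => ?_⟩
    · change φ (MulOpposite.op a • x) = MulOpposite.op a • φ x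
      rw [← hop, map_smul, hop]
    · change φ (M.act h x) = M.act h (φ x)
      have hφ : ∀ x, φ (M.act g x) = M.act g (φ x) := fun x => by
        rw [hact, hact, ← hop, ← hK, LinearMap.map_smul φ, LinearMap.map_smul φ, hop, hK]
      obtain ⟨j, rfl⟩ := hg h
      induction j generalizing x with
      | zero => simp
      | succ j ih =>
        rw [pow_succ, map_mul]
        change φ (M.act (g ^ j) (M.act g x)) = M.act (g ^ j) (M.act g (φ x))
        rw [ih, hφ]
  let f' : Module.End (Module.End R M.carrier) M.carrier :=
    { toFun := f
      map_add' := map_add f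
      map_smul' := fun φ x => by
        obtain ⟨d, hd⟩ := hend φ
        change f (φ x) = φ (f x)
        rw [hd, hd, map_smul] }
  -- Density gives agreement only on finite sets; a finite spanning set is enough.
  obtain ⟨s, hs⟩ := Module.Finite.fg_top (R := k) (M := M.carrier)
  obtain ⟨r, hr⟩ := jacobson_density f' s
  refine ⟨r, ?_⟩
  have h : (hM.repTensor r).restrictScalars k = f.restrictScalars k := by
    refine LinearMap.ext_on (s := (s : Set M.carrier)) hs fun x hx => ?_
    exact (hr x hx).symm
  exact LinearMap.ext fun x => DFunLike.congr_fun h x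

theorem IsSimpleWithEnd.finrank_mul_finrank [Module.Finite k D] (hA : A.IsAzumaya) (hM : IsSimpleWithEnd M D)
    {u : A.carrierˣ} {t : K}
    (ht : ∀ x : M.carrier, t • x = MulOpposite.op (u : A.carrier) • M.act g x)
    (hg : ∀ h : G, ∃ j : ℕ, g ^ j = h) :
    Module.finrank k K * Module.finrank k A.carrier =
      Module.finrank D M.carrier ^ 2 * Module.finrank k D := by
  have : Module.Finite D M.carrier := Module.Finite.of_restrictScalars_finite k D _
  have h := (LinearEquiv.ofBijective (hM.repTensor (K := K)).toLinearMap
    ⟨hM.repTensor_injective hA, hM.repTensor_surjective ht hg⟩)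
  have h1 := (h.restrictScalars k).finrank_eq
  rw [Module.finrank_tensorProduct, finrank_linearMap_divisionRing,
    ← (MulOpposite.opLinearEquiv k : A.carrier ≃ₗ[k] A.carrierᵐᵒᵖ).finrank_eq,
    ← Module.finrank_mul_finrank k D M.carrier] at h1
  rw [h1]
  ring

/-- A field of scalars commuting with `D` that contains the operator `t` exhausts the center. -/
theorem IsSimpleWithEnd.algebraMap_surjective (hA : A.IsAzumaya) (hM : IsSimpleWithEnd M D)
    {u : A.carrierˣ} {t : K}
    (ht : ∀ x : M.carrier, t • x = MulOpposite.op (u : A.carrier) • M.act g x)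
    (hg : ∀ h : G, ∃ j : ℕ, g ^ j = h) (z : D) (hz : ∀ d, d * z = z * d) :
    ∃ l : K, algebraMap K D l = z := by
  have := hM.nontrivial
  let f : Module.End D M.carrier :=
    { toFun := fun x => z • x
      map_add' := smul_add z
      map_smul' := fun d x => by rw [RingHom.id_apply, smul_smul, smul_smul, hz] }
  obtain ⟨r, hr⟩ := hM.repTensor_surjective ht hg f
  have hr' : hM.repTensor (K := K) r = f := hr
  -- The preimage r of multiplication by z is central because K ⊗ Aᵐᵒᵖ acts D-linearly. Centrality
  -- of this Azumaya algebra over K puts r in K.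
  have hcomm : ∀ s : K ⊗[k] A.carrierᵐᵒᵖ, s * r = r * s := fun s => by
    refine hM.repTensor_injective hA ?_
    rw [map_mul, map_mul, hr']
    ext x
    exact map_smul (hM.repTensor s) z x
  obtain ⟨l, hl⟩ := (hA.opposite.extendScalars K).exists_algebraMap r hcomm
  refine ⟨l, ?_⟩
  obtain ⟨x₀, hx₀⟩ := exists_ne (0 : M.carrier)
  refine smul_left_injective D hx₀ ?_
  change algebraMap K D l • x₀ = f x₀
  rw [← hr, ← hl, algebraMap_smul]
  exact ((hM.repTensor_tmul l 1 x₀).trans (by rw [one_smul])).symm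

end DoubleCentralizer
end ClassifyingStack

/-! ### The constant a modulo n-th powers as a Brauer invariant -/

namespace ClassifyingStack

variable {G k : Type u} [Group G] [Field k]

open AlgebraSheaf

/-- T⁻¹w commutes with every endomorphism, so w = cT for a scalar c, and T^n = 1 gives w^n = c^n. -/
theorem exists_pow_eq_of_conj {V : Type u} [AddCommGroup V] [Module k V] [Nontrivial V]
    (T : V ≃ₗ[k] V) (w : Module.End k V) {n : ℕ} {a : k}
    (hw : ∀ b : Module.End k V, (T.toLinearMap ∘ₗ b ∘ₗ T.symm.toLinearMap) * w = w * b)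
    (hwn : w ^ n = algebraMap k _ a) (hT : T.toLinearMap ^ n = 1) : ∃ c : k, c ^ n = a := by
  have hc : T.symm.toLinearMap * w ∈ Subalgebra.center k (Module.End k V) := by
    rw [Subalgebra.mem_center_iff]
    intro b
    rw [mul_assoc, ← hw]
    ext x
    simp
  rw [Algebra.IsCentral.center_eq_bot, Algebra.mem_bot] at hc
  obtain ⟨c, hc⟩ := hc
  have h3 : w = algebraMap k _ c * T.toLinearMap := by
    rw [Algebra.commutes, hc]
    ext x
    simp
  have h4 : Commute (algebraMap k (Module.End k V) c) T.toLinearMap := Algebra.commutes c _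
  refine ⟨c, FaithfulSMul.algebraMap_injective k (Module.End k V) ?_⟩
  rw [← hwn, h3, h4.mul_pow, hT, mul_one, map_pow]

/-- The descent datum at `g` is conjugation by an element with `n`-th power `a`. -/
def IsConjBy (X : AlgebraSheaf G k) (g : G) (n : ℕ) (a : k) : Prop :=
  ∃ w : X.carrier, (∀ b, X.act g b * w = w * b) ∧ w ^ n = algebraMap k X.carrier a

namespace IsConjBy

variable {X Y : AlgebraSheaf G k} {g : G} {n : ℕ} {a b : k}

theorem structureSheaf : IsConjBy (structureSheaf G k) g n 1 :=
  ⟨1, fun b => by rw [mul_one, one_mul]; rfl, by rw [one_pow, map_one]⟩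

theorem act_pow_eq_one (E : VectorBundle G k) (hg : g ^ n = 1) :
    (E.act g).toLinearMap ^ n = 1 := by
  have hpow : ∀ j : ℕ, (E.act g).toLinearMap ^ j = (E.act (g ^ j)).toLinearMap := by
    intro j
    induction j with
    | zero => rw [pow_zero, pow_zero, map_one]; rfl
    | succ j ih => rw [pow_succ, ih, pow_succ, map_mul]; rfl
  rw [hpow, hg, map_one]
  rfl

theorem endomorphisms (E : VectorBundle G k) (hg : g ^ n = 1) :
    IsConjBy (endomorphisms E) g n 1 := by
  refine ⟨(E.act g).toLinearMap, fun f => ?_, ?_⟩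
  · have key : ∀ f : Module.End k E.carrier,
        ((E.act g).toLinearMap ∘ₗ f ∘ₗ (E.act g).symm.toLinearMap) * (E.act g).toLinearMap =
          (E.act g).toLinearMap * f := fun f => by
      ext x
      simp
    exact key f
  · rw [map_one]
    exact act_pow_eq_one E hg

theorem of_iso (e : Iso X Y) (h : IsConjBy X g n a) : IsConjBy Y g n a := by
  obtain ⟨w, hw, hwn⟩ := h
  refine ⟨e.toAlgEquiv w, fun b => ?_, ?_⟩
  · obtain ⟨b, rfl⟩ := e.toAlgEquiv.surjective b
    rw [← e.map_act, ← map_mul, hw, map_mul]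
  · rw [← map_pow, hwn, AlgEquiv.commutes]

theorem tensor (h : IsConjBy X g n a) (h' : IsConjBy Y g n b) :
    IsConjBy (X.tensor Y) g n (a * b) := by
  obtain ⟨w, hw, hwn⟩ := h
  obtain ⟨v, hv, hvn⟩ := h'
  have key : ∀ x : X.carrier ⊗[k] Y.carrier,
      Algebra.TensorProduct.congr (X.act g) (Y.act g) x * (w ⊗ₜ[k] v) = (w ⊗ₜ[k] v) * x := by
    intro x
    induction x with
    | zero => simp
    | add x y hx hy => rw [map_add, add_mul, mul_add, hx, hy]
    | tmul x y => simp [hw, hv]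
  have key' : (w ⊗ₜ[k] v) ^ n = algebraMap k (X.carrier ⊗[k] Y.carrier) (a * b) := by
    rw [Algebra.TensorProduct.tmul_pow, hwn, hvn, Algebra.algebraMap_eq_smul_one,
      Algebra.algebraMap_eq_smul_one, TensorProduct.smul_tmul_smul,
      Algebra.algebraMap_eq_smul_one, Algebra.TensorProduct.one_def]
  exact ⟨w ⊗ₜ v, key, key'⟩

theorem exists_nsmul {X : Azumaya G k} (h : IsConjBy X.toAlgebraSheaf g n a) (m : ℕ) :
    ∃ Z : Azumaya G k, Z.brauerClass = m • X.brauerClass ∧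
      IsConjBy Z.toAlgebraSheaf g n (a ^ m) := by
  induction m with
  | zero =>
    refine ⟨⟨AlgebraSheaf.structureSheaf G k, structureSheaf_isAzumaya⟩, (zero_nsmul _).symm, ?_⟩
    rw [pow_zero]
    exact structureSheaf
  | succ j ih =>
    obtain ⟨Z, hZ, hN⟩ := ih
    refine ⟨⟨Z.tensor X.toAlgebraSheaf, Z.isAzumaya.tensor X.isAzumaya⟩, ?_, ?_⟩
    · rw [succ_nsmul, ← hZ]
      rfl
    · rw [pow_succ]
      exact hN.tensor h

/-- On the endomorphisms of a vector bundle, the constant is an `n`-th power. -/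
theorem exists_pow_eq (E : VectorBundle G k) (hg : g ^ n = 1)
    (h : IsConjBy (AlgebraSheaf.endomorphisms E) g n a) : ∃ c : k, c ^ n = a := by
  obtain ⟨w, hw, hwn⟩ := h
  exact exists_pow_eq_of_conj (E.act g) w hw hwn (act_pow_eq_one E hg)

/-- On an algebra with trivial Brauer class, the constant is an `n`-th power. -/
theorem exists_pow_eq_of_brauerClass_eq_zero {X : Azumaya G k} (hX : X.brauerClass = 0)
    (hg : g ^ n = 1) (h : IsConjBy X.toAlgebraSheaf g n a) : ∃ c : k, c ^ n = a := by
  obtain ⟨E, F, ⟨e⟩⟩ := Quotient.exact hX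
  -- Tensoring with End(E) multiplies the constant by 1, and the result is isomorphic to End(F).
  have h1 := (h.tensor (endomorphisms E hg)).of_iso (e.trans (Iso.unitTensor _))
  rw [mul_one] at h1
  exact exists_pow_eq F hg h1

end IsConjBy
end ClassifyingStack

/-! ### Kummer theory -/

namespace ClassifyingStack

section Kummer

open Polynomial IntermediateField

variable {k : Type u} [Field k] {n : ℕ}

theorem exists_isPrimitiveRoot (hn : (n : k) ≠ 0) (hk : (X ^ n - 1 : k[X]).Splits) :
    ∃ ζ : k, IsPrimitiveRoot ζ n := by
  have : NeZero (n : k) := ⟨hn⟩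
  have hn0 : 0 < n := Nat.pos_of_ne_zero fun h => hn (by rw [h, Nat.cast_zero])
  have hne : (X ^ n - 1 : k[X]) ≠ 0 := by simpa using X_pow_sub_C_ne_zero hn0 (1 : k)
  obtain ⟨ζ, hζ⟩ := (hk.of_dvd hne (cyclotomic.dvd_X_pow_sub_one n k)).exists_eval_eq_zero
    (degree_cyclotomic_pos n k hn0).ne'
  exact ⟨ζ, isRoot_cyclotomic_iff.1 hζ⟩

variable {L : Type u} [Field L] [Algebra k L] {ζ : k}

theorem exists_algebraMap_of_pow_eq_one [NeZero n] (hζ : IsPrimitiveRoot ζ n) {l : L}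
    (hl : l ^ n = 1) : ∃ r : k, algebraMap k L r = l := by
  obtain ⟨i, -, hi⟩ :=
    (hζ.map_of_injective (algebraMap k L).injective).eq_pow_of_pow_eq_one hl
  exact ⟨ζ ^ i, by rw [map_pow, hi]⟩

/-- The quotient σ(t)/t is an n-th root of unity, and these all lie in k. -/
theorem exists_smul_of_pow_eq [NeZero n] (hζ : IsPrimitiveRoot ζ n) {t : L} {a : k}
    (ht : t ^ n = algebraMap k L a) (ht0 : t ≠ 0) (σ : L ≃ₐ[k] L) : ∃ z : k, σ t = z • t := by
  obtain ⟨z, hz⟩ := exists_algebraMap_of_pow_eq_one (L := L) hζ (l := σ t / t) (by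
    rw [div_pow, ← map_pow, ht, AlgEquiv.commutes, ← ht, div_self (pow_ne_zero _ ht0)])
  exact ⟨z, by rw [Algebra.smul_def, hz, div_mul_cancel₀ _ ht0]⟩

theorem eq_one_of_apply_eq {t : L} (htop : k⟮t⟯ = ⊤) {τ : L ≃ₐ[k] L} (h : τ t = t) : τ = 1 := by
  have h1 : k⟮t⟯ ≤ IntermediateField.fixedField (Subgroup.zpowers τ) := by
    rw [IntermediateField.adjoin_simple_le_iff]
    rintro ⟨ρ, hρ⟩
    have h2 : Subgroup.zpowers τ ≤ MulAction.stabilizer (L ≃ₐ[k] L) t := by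
      rw [Subgroup.zpowers_le]
      exact h
    exact h2 hρ
  ext x
  rw [htop] at h1
  exact h1 (IntermediateField.mem_top : x ∈ ⊤) ⟨τ, Subgroup.mem_zpowers τ⟩

/-- A Kummer extension has cyclic Galois group. -/
theorem exists_generator_galois [FiniteDimensional k L] (hn : (n : k) ≠ 0) (hζ : IsPrimitiveRoot ζ n) {t : L} {a : k}
    (ht : t ^ n = algebraMap k L a) (ht0 : t ≠ 0) (htop : k⟮t⟯ = ⊤) :
    ∃ σ : L ≃ₐ[k] L, orderOf σ = Module.finrank k L ∧
      ∀ l, σ l = l → ∃ r : k, algebraMap k L r = l := by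
  have hn0 : n ≠ 0 := fun h => hn (by rw [h, Nat.cast_zero])
  have : NeZero n := ⟨hn0⟩
  have ha : a ≠ 0 := by
    rintro rfl
    rw [map_zero] at ht
    exact ht0 (pow_eq_zero_iff hn0 |>.1 ht)
  have hζL := hζ.map_of_injective (algebraMap k L).injective
  have hsplit : (X ^ n - C a : k[X]).IsSplittingField k L := by
    constructor
    · rw [Polynomial.map_sub, Polynomial.map_pow, map_X, map_C]
      exact X_pow_sub_C_splits_of_isPrimitiveRoot hζL ht
    · rw [eq_top_iff, ← IntermediateField.top_toSubalgebra, ← htop,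
        IntermediateField.adjoin_simple_toSubalgebra_of_isAlgebraic (IsAlgebraic.of_finite k t)]
      apply Algebra.adjoin_mono
      rw [Set.singleton_subset_iff, mem_rootSet_of_ne (X_pow_sub_C_ne_zero
        (Nat.pos_of_ne_zero hn0) a)]
      simp [ht]
  have hgal : IsGalois k L := IsGalois.of_separable_splitting_field
    (p := (X ^ n - C a : k[X])) (separable_X_pow_sub_C a hn ha)
  have hadj : ∀ σ τ : L ≃ₐ[k] L, σ t = τ t → σ = τ := fun σ τ h =>
    (inv_mul_eq_one.1 (eq_one_of_apply_eq htop (τ := τ⁻¹ * σ) (by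
      rw [AlgEquiv.mul_apply, h]
      exact τ.symm_apply_apply t))).symm
  -- The Kummer character is multiplicative because its values lie in k and are fixed by the
  -- automorphisms. It is injective because t generates L.
  let f : (L ≃ₐ[k] L) →* L :=
    { toFun := fun σ => σ t / t
      map_one' := div_self ht0
      map_mul' := fun σ τ => by
        obtain ⟨z, hz⟩ := exists_smul_of_pow_eq hζ ht ht0 τ
        rw [AlgEquiv.mul_apply, hz, map_smul, Algebra.smul_def, Algebra.smul_def]
        field_simp }
  have hcyc : IsCyclic (L ≃ₐ[k] L) := isCyclic_of_injective_ringHom f fun σ τ h =>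
    hadj σ τ ((div_left_inj' ht0).1 h)
  obtain ⟨σ, hσ⟩ := hcyc.exists_generator
  refine ⟨σ, ?_, fun l hl => ?_⟩
  · rw [orderOf_eq_card_of_forall_mem_zpowers hσ, IsGalois.card_aut_eq_finrank]
  · have : ∀ τ : L ≃ₐ[k] L, τ l = l := fun τ => by
      have h1 : Subgroup.zpowers σ ≤ MulAction.stabilizer (L ≃ₐ[k] L) l := by
        rw [Subgroup.zpowers_le]
        exact hl
      exact h1 (hσ τ)
    exact (IsGalois.mem_range_algebraMap_iff_fixed l).2 this

/-- The generator of the Galois group acts on a Kummer generator by a primitive root of unity. -/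
theorem isPrimitiveRoot_of_smul {t : L} (ht0 : t ≠ 0) (htop : k⟮t⟯ = ⊤) {σ : L ≃ₐ[k] L} {z : k}
    (hz : σ t = z • t) : IsPrimitiveRoot z (orderOf σ) := by
  have hpow : ∀ j : ℕ, (σ ^ j) t = z ^ j • t := by
    intro j
    induction j with
    | zero => simp
    | succ j ih => rw [pow_succ, AlgEquiv.mul_apply, hz, map_smul, ih, smul_smul, pow_succ']
  constructor
  · have h := hpow (orderOf σ)
    rw [pow_orderOf_eq_one] at h
    refine smul_left_injective k ht0 ?_
    change z ^ _ • t = (1 : k) • t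
    rw [← h, one_smul]
    rfl
  · intro j hj
    apply orderOf_dvd_of_pow_eq_one
    apply eq_one_of_apply_eq htop
    rw [hpow, hj, one_smul]

/-- If a^m = c^n, then t^m/c is an n-th root of unity, so t^m lies in k and is fixed by σ. Thus z^m
= 1, where z = σ(t)/t is a primitive root of order `orderOf σ`. -/
theorem dvd_of_pow_eq [NeZero n] (hζ : IsPrimitiveRoot ζ n) {t : L} {a : k}
    (ht : t ^ n = algebraMap k L a) (ht0 : t ≠ 0) (htop : k⟮t⟯ = ⊤) (σ : L ≃ₐ[k] L) {m : ℕ} {c : k}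
    (hc : c ^ n = a ^ m) : orderOf σ ∣ m := by
  obtain ⟨z, hz⟩ := exists_smul_of_pow_eq hζ ht ht0 σ
  have hprim := isPrimitiveRoot_of_smul ht0 htop hz
  apply hprim.dvd_of_pow_eq_one
  have htm : t ^ m ≠ 0 := pow_ne_zero _ ht0
  have hpow : (t ^ m) ^ n = algebraMap k L c ^ n := by
    rw [← map_pow, hc, map_pow, ← ht, ← pow_mul, ← pow_mul, mul_comm]
  have hc0 : algebraMap k L c ≠ 0 := fun h => by
    rw [h, zero_pow (NeZero.ne n)] at hpow
    exact pow_ne_zero _ htm hpow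
  obtain ⟨r, hr⟩ := exists_algebraMap_of_pow_eq_one (L := L) hζ (l := t ^ m / algebraMap k L c) (by
    rw [div_pow, hpow, div_self (pow_ne_zero _ hc0)])
  have hfix : σ (t ^ m) = t ^ m := by
    have : t ^ m = algebraMap k L (r * c) := by
      rw [map_mul, hr, div_mul_cancel₀ _ hc0]
    rw [this, AlgEquiv.commutes]
  refine smul_left_injective k htm ?_
  change z ^ m • t ^ m = (1 : k) • t ^ m
  rw [one_smul, ← _root_.smul_pow, ← hz, ← map_pow, hfix]

end Kummer
end ClassifyingStack

/-! ### Hom_D(M, N) as an equivariant splitting of A ⊗ Bᵐᵒᵖ over L -/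

namespace ClassifyingStack

variable {G k : Type u} [Group G] [Field k]

open AlgebraSheaf

section HomModule

variable {A B : AlgebraSheaf G k} {M : CohMod A} {N : CohMod B} {D L : Type u} [DivisionRing D]
  [Field L] [Algebra k L] [Algebra k D] [Algebra L D]
  [Module D M.carrier] [IsScalarTower k D M.carrier]
  [Module D N.carrier] [Module L N.carrier]
  [IsScalarTower L D N.carrier] [IsScalarTower k D N.carrier] [IsScalarTower k L N.carrier]

/-- The descent datum on a simple module by `D`-linear maps. -/
def IsSimpleWithEnd.actEnd (hM : IsSimpleWithEnd M D) : G →* Module.End D M.carrier where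
  toFun g :=
    { toFun := fun x => M.act g x
      map_add' := map_add (M.act g)
      map_smul' := hM.act_smul g }
  map_one' := by
    ext x
    exact DFunLike.congr_fun (map_one M.act) x
  map_mul' g h := by
    ext x
    exact DFunLike.congr_fun (map_mul M.act g h) x

/-- The descent datum on the `D`-linear maps from `M` to `N`. -/
def homAct (hM : IsSimpleWithEnd M D) (hN : IsSimpleWithEnd N D) :
    G →* ((M.carrier →ₗ[D] N.carrier) ≃ₗ[L] (M.carrier →ₗ[D] N.carrier)) :=
  let φ : G →* Module.End L (M.carrier →ₗ[D] N.carrier) :=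
    { toFun := fun g =>
        { toFun := fun f => hN.actEnd g ∘ₗ f ∘ₗ hM.actEnd g⁻¹
          map_add' := fun f f' => by rw [LinearMap.add_comp, LinearMap.comp_add]
          map_smul' := fun l f => by
            ext x
            change hN.actEnd g (l • f (hM.actEnd g⁻¹ x)) = l • hN.actEnd g (f (hM.actEnd g⁻¹ x))
            rw [← algebraMap_smul D l, map_smul, algebraMap_smul] }
      map_one' := by
        ext f x
        simp
      map_mul' := fun g h => by
        ext f x
        simp }
  (LinearMap.GeneralLinearGroup.generalLinearEquiv L _).toMonoidHom.comp φ.toHomUnits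

/-- The action of `A` on the `D`-linear maps from `M` to `N` through the source. -/
noncomputable def homRepLeft (hM : IsSimpleWithEnd M D) :
    A.carrier →ₐ[k] Module.End L (M.carrier →ₗ[D] N.carrier) :=
  { toFun := fun a =>
      { toFun := fun f => f ∘ₗ hM.rep (MulOpposite.op a)
        map_add' := fun f f' => rfl
        map_smul' := fun l f => rfl }
    map_one' := by
      ext f x
      simp
    map_mul' := fun a b => by
      ext f x
      simp
    map_zero' := by
      ext f x
      simp
    map_add' := fun a b => by
      ext f x
      simp
    commutes' := fun r => by
      ext f x
      change f (algebraMap k A.carrierᵐᵒᵖ r • x) = r • f x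
      rw [algebraMap_smul, ← algebraMap_smul D r x, map_smul, algebraMap_smul] }

/-- The action of `Bᵐᵒᵖ` on the `D`-linear maps from `M` to `N` through the target. -/
noncomputable def homRepRight (hN : IsSimpleWithEnd N D) :
    B.carrierᵐᵒᵖ →ₐ[k] Module.End L (M.carrier →ₗ[D] N.carrier) :=
  { toFun := fun b =>
      { toFun := fun f => hN.rep b ∘ₗ f
        map_add' := fun f f' => by rw [LinearMap.comp_add]
        map_smul' := fun l f => by
          ext x
          change hN.rep b (l • f x) = l • hN.rep b (f x)
          rw [← algebraMap_smul D l, map_smul, algebraMap_smul] }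
    map_one' := by
      ext f x
      simp
    map_mul' := fun a b => by
      ext f x
      simp
    map_zero' := by
      ext f x
      simp
    map_add' := fun a b => by
      ext f x
      simp
    commutes' := fun r => by
      ext f x
      change algebraMap k B.carrierᵐᵒᵖ r • f x = r • f x
      rw [algebraMap_smul] }

/-- The action of `A ⊗ Bᵐᵒᵖ` on the `D`-linear maps from `M` to `N`. -/
noncomputable def homRep (hM : IsSimpleWithEnd M D) (hN : IsSimpleWithEnd N D) :
    A.carrier ⊗[k] B.carrierᵐᵒᵖ →ₐ[k] Module.End L (M.carrier →ₗ[D] N.carrier) :=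
  Algebra.TensorProduct.lift (homRepLeft hM) (homRepRight hN) fun a b => by
    ext f x
    rfl

theorem homRep_tmul (hM : IsSimpleWithEnd M D) (hN : IsSimpleWithEnd N D) (a : A.carrier)
    (b : B.carrierᵐᵒᵖ) (f : M.carrier →ₗ[D] N.carrier) (x : M.carrier) :
    homRep (L := L) hM hN (a ⊗ₜ b) f x = b • f (MulOpposite.op a • x) := by
  have h : homRep (L := L) hM hN (a ⊗ₜ b) = homRepLeft hM a * homRepRight hN b :=
    Algebra.TensorProduct.lift_tmul _ _ _ a b
  rw [h]
  rfl

theorem homAct_homRep (hM : IsSimpleWithEnd M D) (hN : IsSimpleWithEnd N D) (g : G)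
    (y : A.carrier ⊗[k] B.carrierᵐᵒᵖ) (f : M.carrier →ₗ[D] N.carrier) :
    homAct (L := L) hM hN g (homRep (L := L) hM hN y f) =
      homRep (L := L) hM hN (Algebra.TensorProduct.congr (A.act g) (AlgEquiv.op (B.act g)) y)
        (homAct (L := L) hM hN g f) := by
  induction y with
  | zero => simp
  | add y z hy hz => simp only [map_add, LinearMap.add_apply, hy, hz]
  | tmul a b =>
    ext x
    change N.act g (homRep (L := L) hM hN (a ⊗ₜ b) f (M.act g⁻¹ x)) = _
    rw [homRep_tmul, Algebra.TensorProduct.congr_apply,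
      Algebra.TensorProduct.map_tmul]
    refine Eq.trans ?_ (homRep_tmul (L := L) hM hN (A.act g a) (MulOpposite.op (B.act g b.unop))
      (homAct (L := L) hM hN g f) x).symm
    change _ = MulOpposite.op (B.act g b.unop) •
      N.act g (f (M.act g⁻¹ (MulOpposite.op (A.act g a) • x)))
    rw [M.act_smul]
    have h1 : A.act g⁻¹ (A.act g a) = a := by
      change (A.act g⁻¹ * A.act g) a = a
      rw [← map_mul, inv_mul_cancel, map_one]
      rfl
    rw [h1, ← N.act_smul]
    rfl

end HomModule

section Main

open IntermediateField

variable {A B : Azumaya G k} {M : CohMod A.toAlgebraSheaf} {N : CohMod B.toAlgebraSheaf}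
  {D L : Type u} [DivisionRing D] [Field L] [Algebra k L]
  [Algebra k D] [Algebra L D]
  [Module D M.carrier] [Module L M.carrier]
  [IsScalarTower L D M.carrier] [IsScalarTower k D M.carrier] [IsScalarTower k L M.carrier]
  [Module D N.carrier] [Module L N.carrier]
  [IsScalarTower L D N.carrier] [IsScalarTower k D N.carrier] [IsScalarTower k L N.carrier]
  {g : G} {n : ℕ}

/-- The operator `t` generates the center of the endomorphism algebra of a simple module. -/
theorem IsSimpleWithEnd.adjoin_eq_top (hM : IsSimpleWithEnd M D)
    (hg : ∀ h : G, ∃ j : ℕ, g ^ j = h) {u : A.carrierˣ} {t : L}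
    (ht : ∀ x : M.carrier, t • x = MulOpposite.op (u : A.carrier) • M.act g x) : k⟮t⟯ = ⊤ := by
  rw [eq_top_iff]
  intro l _
  have : IsScalarTower k k⟮t⟯ M.carrier := ⟨fun r κ x => smul_assoc r (κ : L) x⟩
  -- The double centralizer argument needs only a field containing t; for k(t) it shows that k(t)
  -- already fills the centre of D.
  obtain ⟨κ, hκ⟩ := hM.algebraMap_surjective (K := k⟮t⟯) A.isAzumaya
    (t := ⟨t, IntermediateField.mem_adjoin_simple_self k t⟩) ht hg (algebraMap L D l)
    fun d => (Algebra.commutes l d).symm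
  have : (κ : L) = l := (algebraMap L D).injective hκ
  rw [← this]
  exact κ.2

/-- If simple modules over `A` and `B` have the same endomorphism algebra `D`, then the difference
of the classes of `A` and `B` is killed by the degree of the center of `D`, and this degree divides
the order of `A`. -/
theorem nsmul_eq_and_dvd [FiniteDimensional k L] [Module.Finite k D]
    [Algebra.IsCentral L D] (hM : IsSimpleWithEnd M D) (hN : IsSimpleWithEnd N D)
    (hn : (n : k) ≠ 0) {ζ : k} (hζ : IsPrimitiveRoot ζ n)
    (hg : ∀ h : G, ∃ j : ℕ, g ^ j = h) (hG : ∀ h : G, h ^ n = 1) :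
    Module.finrank k L • A.brauerClass = Module.finrank k L • B.brauerClass ∧
      ∀ m : ℕ, m • A.brauerClass = 0 → Module.finrank k L ∣ m := by
  have hn0 : n ≠ 0 := fun h => hn (by rw [h, Nat.cast_zero])
  have : NeZero n := ⟨hn0⟩
  obtain ⟨u, a, t, hu, ha, htn, ht0, ht⟩ := hM.exists_pow_eq (L := L) A.isAzumaya (hG g) hn0 hg
  obtain ⟨v, b, s, -, -, -, -, hs⟩ := hN.exists_pow_eq (L := L) B.isAzumaya (hG g) hn0 hg
  have htop := hM.adjoin_eq_top hg ht
  obtain ⟨σ, hσ, hfix⟩ := exists_generator_galois hn hζ htn ht0 htop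
  constructor
  · have hdA := hM.finrank_mul_finrank A.isAzumaya ht hg
    have hdB := hN.finrank_mul_finrank B.isAzumaya hs hg
    have : Module.Finite D M.carrier := Module.Finite.of_restrictScalars_finite k D _
    have : Module.Finite D N.carrier := Module.Finite.of_restrictScalars_finite k D _
    have := hM.nontrivial
    have := hN.nontrivial
    have hW := finrank_linearMap_divisionRing k D M.carrier N.carrier
    rw [← Module.finrank_mul_finrank k D N.carrier,
      ← Module.finrank_mul_finrank k L (M.carrier →ₗ[D] N.carrier)] at hW
    have hpos : 0 < Module.finrank k L := Module.finrank_pos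
    -- Multiply the identities [L:k] dim A = (dim_D M)² dim_k D and its analogue for B, and compare
    -- with [L:k] dim_L Hom_D(M, N) = dim_D M · dim_D N · dim_k D.
    have hsq : Module.finrank L (M.carrier →ₗ[D] N.carrier) ^ 2 =
        Module.finrank k A.carrier * Module.finrank k B.carrier := by
      refine Nat.eq_of_mul_eq_mul_left (pow_pos hpos 2) ?_
      rw [← mul_pow, hW]
      calc _ = (Module.finrank D M.carrier ^ 2 * Module.finrank k D) *
            (Module.finrank D N.carrier ^ 2 * Module.finrank k D) := by ring
        _ = _ := by rw [← hdA, ← hdB]; ring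
    have hfinW : Module.Finite L (M.carrier →ₗ[D] N.carrier) := by
      have : Module.Finite k (M.carrier →ₗ[D] N.carrier) :=
        Module.Finite.equiv ((Module.finBasis D M.carrier).constr k (M' := N.carrier))
      exact Module.Finite.of_restrictScalars_finite k L _
    have hntW : Nontrivial (M.carrier →ₗ[D] N.carrier) := inferInstance
    let X : Azumaya G k := ⟨A.tensor B.opposite, A.isAzumaya.tensor B.isAzumaya.opposite⟩
    have hX : X.brauerClass = A.brauerClass - B.brauerClass := by
      rw [sub_eq_add_neg]
      rfl
    have hXd : Module.finrank L (M.carrier →ₗ[D] N.carrier) ^ 2 = Module.finrank k X.carrier := by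
      rw [hsq, (MulOpposite.opLinearEquiv k : B.carrier ≃ₗ[k] B.carrierᵐᵒᵖ).finrank_eq]
      exact (Module.finrank_tensorProduct (R := k) (S := k)
        (M := A.carrier) (M' := B.carrierᵐᵒᵖ)).symm
    obtain ⟨z, hz⟩ := exists_smul_of_pow_eq hζ htn ht0 σ
    have h := X.nsmul_brauerClass_eq_zero (L := L) (homRep hM hN) hXd (homAct hM hN)
      (homAct_homRep hM hN) σ hpos rfl (by rw [← hσ, pow_orderOf_eq_one]) hfix hG
      (fun l hl => exists_algebraMap_of_pow_eq_one hζ hl)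
      (hσ ▸ isPrimitiveRoot_of_smul ht0 htop hz) ht0 hz
    rwa [hX, nsmul_sub, sub_eq_zero] at h
  · intro m hm
    obtain ⟨Z, hZ, hconj⟩ := IsConjBy.exists_nsmul (X := A) (g := g) (n := n) (a := a)
      ⟨u, hu, by rw [← ha, Units.val_pow_eq_pow_val]⟩ m
    obtain ⟨c, hc⟩ := IsConjBy.exists_pow_eq_of_brauerClass_eq_zero (hZ.trans hm) (hG g) hconj
    rw [← hσ]
    exact dvd_of_pow_eq hζ htn ht0 htop σ hc

end Main
end ClassifyingStack

/-! ### The centre of D, and simple objects under a Morita equivalence -/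

namespace ClassifyingStack

variable {G k : Type u} [Group G] [Field k]

open AlgebraSheaf

theorem exists_center (D : Type u) [DivisionRing D] [Algebra k D] [Module.Finite k D] :
    ∃ (L : Type u) (_ : Field L) (_ : Algebra k L) (_ : Algebra L D), FiniteDimensional k L ∧
      IsScalarTower k L D ∧ Algebra.IsCentral L D := by
  have hfield : IsField (Subalgebra.center k D) :=
    isField_of_isIntegral_of_isField' (Field.toIsField k)
  let a₁ : Algebra k (Subalgebra.center k D) := inferInstance
  let a₂ : Algebra (Subalgebra.center k D) D :=
    ((Subalgebra.center k D).val : Subalgebra.center k D →+* D).toAlgebra'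
      fun z d => (Subalgebra.mem_center_iff.1 z.2 d).symm
  have hcentral : Algebra.IsCentral (Subalgebra.center k D) D := ⟨fun z hz => by
    rw [Subalgebra.mem_center_iff] at hz
    exact Algebra.mem_bot.2 ⟨⟨z, Subalgebra.mem_center_iff.2 hz⟩, rfl⟩⟩
  have hfin : Module.Finite k (Subalgebra.center k D) := inferInstance
  have htower : @IsScalarTower k (Subalgebra.center k D) D a₁.toSMul a₂.toSMul _ :=
    ⟨fun c z d => smul_mul_assoc c (z : D) d⟩
  exact ⟨Subalgebra.center k D, hfield.toField, a₁, a₂, hfin, htower, hcentral⟩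

/-- The integer e is the degree of the centre of D, which depends on D alone. The roles of A and B
can therefore be exchanged without changing e. -/
theorem exists_nsmul_eq {A B : Azumaya G k} {M : CohMod A.toAlgebraSheaf}
    {N : CohMod B.toAlgebraSheaf} {D : Type u} [DivisionRing D] [Algebra k D] [Module.Finite k D]
    [Module D M.carrier] [IsScalarTower k D M.carrier]
    [Module D N.carrier] [IsScalarTower k D N.carrier]
    (hM : IsSimpleWithEnd M D) (hN : IsSimpleWithEnd N D)
    {n : ℕ} (hn : (n : k) ≠ 0) {ζ : k} (hζ : IsPrimitiveRoot ζ n) {g : G}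
    (hg : ∀ h : G, ∃ j : ℕ, g ^ j = h) (hG : ∀ h : G, h ^ n = 1) :
    ∃ e : ℕ, e • A.brauerClass = e • B.brauerClass ∧ (∀ m : ℕ, m • A.brauerClass = 0 → e ∣ m) ∧
      ∀ m : ℕ, m • B.brauerClass = 0 → e ∣ m := by
  obtain ⟨L, _, _, _, _, _, _⟩ := exists_center (k := k) D
  let _ : Module L M.carrier := Module.compHom M.carrier (algebraMap L D)
  let _ : Module L N.carrier := Module.compHom N.carrier (algebraMap L D)
  have hLM : IsScalarTower L D M.carrier := ⟨fun l d x => by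
    rw [Algebra.smul_def, mul_smul]
    rfl⟩
  have hLN : IsScalarTower L D N.carrier := ⟨fun l d x => by
    rw [Algebra.smul_def, mul_smul]
    rfl⟩
  have hkM : IsScalarTower k L M.carrier := ⟨fun c l x => by
    rw [← algebraMap_smul D (c • l), ← algebraMap_smul D l, Algebra.smul_def, map_mul, mul_smul,
      ← IsScalarTower.algebraMap_apply, algebraMap_smul]⟩
  have hkN : IsScalarTower k L N.carrier := ⟨fun c l x => by
    rw [← algebraMap_smul D (c • l), ← algebraMap_smul D l, Algebra.smul_def, map_mul, mul_smul,
      ← IsScalarTower.algebraMap_apply, algebraMap_smul]⟩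
  have h1 := nsmul_eq_and_dvd (L := L) hM hN hn hζ hg hG
  have h2 := nsmul_eq_and_dvd (L := L) hN hM hn hζ hg hG
  exact ⟨_, h1.1, h1.2, h2.2⟩

namespace CohMod

open CategoryTheory

variable {A : AlgebraSheaf G k}

/-- A stable subspace is a subobject. -/
def ofSubmodule (M : CohMod A) (N : Submodule k M.carrier)
    (h₁ : ∀ (a : A.carrier), ∀ x ∈ N, MulOpposite.op a • x ∈ N)
    (h₂ : ∀ g, ∀ x ∈ N, M.act g x ∈ N) : CohMod A :=
  let φ : G →* Module.End k N :=
    { toFun := fun g => (M.act g).toLinearMap.restrict (h₂ g)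
      map_one' := by ext x; simp
      map_mul' := fun g h => by ext x; simp }
  let _ : Module A.carrierᵐᵒᵖ N :=
    { smul := fun a x => ⟨a • x.1, h₁ a.unop x.1 x.2⟩
      one_smul := fun x => Subtype.ext (one_smul _ x.1)
      mul_smul := fun a b x => Subtype.ext (mul_smul a b x.1)
      smul_zero := fun a => Subtype.ext (smul_zero a)
      smul_add := fun a x y => Subtype.ext (smul_add a x.1 y.1)
      add_smul := fun a b x => Subtype.ext (add_smul a b x.1)
      zero_smul := fun x => Subtype.ext (zero_smul _ x.1) }
  { carrier := N
    isScalarTower := ⟨fun c a x => Subtype.ext (smul_assoc c a x.1)⟩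
    act := (LinearMap.GeneralLinearGroup.generalLinearEquiv k N).toMonoidHom.comp φ.toHomUnits
    act_smul := fun g a x => Subtype.ext (M.act_smul g a x.1) }

/-- The inclusion of a stable subspace. -/
def ofSubmoduleι (M : CohMod A) (N : Submodule k M.carrier)
    (h₁ : ∀ (a : A.carrier), ∀ x ∈ N, MulOpposite.op a • x ∈ N)
    (h₂ : ∀ g, ∀ x ∈ N, M.act g x ∈ N) : M.ofSubmodule N h₁ h₂ ⟶ M :=
  ⟨N.subtype, fun _ _ => rfl, fun _ _ => rfl⟩

/-- The algebra as a right module over itself. -/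
def self (A : AlgebraSheaf G k) [Module.Finite k A.carrier] : CohMod A where
  carrier := A.carrier
  isScalarTower := ⟨fun c a x => by
    change x * (c • a).unop = c • (x * a.unop)
    rw [MulOpposite.unop_smul, mul_smul_comm]⟩
  act :=
    { toFun := fun g => (A.act g).toLinearEquiv
      map_one' := by rw [map_one]; rfl
      map_mul' := fun g h => by rw [map_mul]; rfl }
  act_smul g a x := map_mul (A.act g) x a

theorem hom_ext {M N : CohMod A} {f f' : M ⟶ N} (h : ∀ x, f.1 x = f'.1 x) : f = f' :=
  Subtype.ext (LinearMap.ext h)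

theorem mono_of_injective {M N : CohMod A} (f : M ⟶ N) (hf : Function.Injective f.1) : Mono f where
  right_cancellation _ _ h := hom_ext fun x =>
    hf (DFunLike.congr_fun (congrArg Subtype.val h) x)

/-- The kernel is a subobject, and its inclusion and the zero map have the same composite with f. -/
theorem injective_of_mono {M N : CohMod A} (f : M ⟶ N) [Mono f] : Function.Injective f.1 := by
  rw [← LinearMap.ker_eq_bot, LinearMap.ker_eq_bot']
  intro x hx
  let ι := M.ofSubmoduleι (LinearMap.ker f.1)
    (fun a x hx => by rw [LinearMap.mem_ker] at hx ⊢; rw [f.2.1, hx, smul_zero])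
    (fun g x hx => by rw [LinearMap.mem_ker] at hx ⊢; rw [f.2.2, hx, map_zero])
  have h : ι ≫ f = 0 ≫ f := hom_ext fun y => by
    change f.1 (y : LinearMap.ker f.1).1 = f.1 0
    rw [map_zero]
    exact y.2
  have h1 := (cancel_mono f).1 h
  exact DFunLike.congr_fun (congrArg Subtype.val h1) (⟨x, hx⟩ : LinearMap.ker f.1)

theorem isIso_of_bijective {M N : CohMod A} (f : M ⟶ N) (hf : Function.Bijective f.1) :
    IsIso f := by
  let e := LinearEquiv.ofBijective f.1 hf
  have he : ∀ x, e x = f.1 x := fun _ => rfl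
  refine ⟨⟨e.symm.toLinearMap, fun a x => e.injective ?_, fun g x => e.injective ?_⟩,
    hom_ext fun x => e.symm_apply_apply x, hom_ext fun x => e.apply_symm_apply x⟩
  · change e (e.symm _) = e (MulOpposite.op a • e.symm x)
    rw [he (MulOpposite.op a • _), f.2.1, ← he, e.apply_symm_apply, e.apply_symm_apply]
  · change e (e.symm _) = e (M.act g (e.symm x))
    rw [he (M.act g _), f.2.2, ← he, e.apply_symm_apply, e.apply_symm_apply]

theorem bijective_of_isIso {M N : CohMod A} (f : M ⟶ N) [IsIso f] : Function.Bijective f.1 := by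
  refine Function.bijective_iff_has_inverse.2 ⟨(inv f).1, fun x => ?_, fun x => ?_⟩
  · exact DFunLike.congr_fun (congrArg Subtype.val (IsIso.hom_inv_id f)) x
  · exact DFunLike.congr_fun (congrArg Subtype.val (IsIso.inv_hom_id f)) x

/-- A module without stable subspaces. -/
structure IsSimple (M : CohMod A) : Prop where
  nontrivial : Nontrivial M.carrier
  eq_bot_or_eq_top : ∀ N : Submodule k M.carrier,
    (∀ (a : A.carrier), ∀ x ∈ N, MulOpposite.op a • x ∈ N) → (∀ g, ∀ x ∈ N, M.act g x ∈ N) →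
      N = ⊥ ∨ N = ⊤

/-- A nonzero module of least dimension has no proper nonzero stable subspace; A itself shows that
nonzero modules exist. -/
theorem exists_isSimple (A : AlgebraSheaf G k) [Module.Finite k A.carrier]
    [Nontrivial A.carrier] : ∃ M : CohMod A, M.IsSimple := by
  classical
  have hex : ∃ d : ℕ, ∃ M : CohMod A, Nontrivial M.carrier ∧ Module.finrank k M.carrier = d :=
    ⟨_, self A, ‹_›, rfl⟩
  obtain ⟨M, hM, hd⟩ := Nat.find_spec hex
  refine ⟨M, hM, fun N h₁ h₂ => ?_⟩
  rcases subsingleton_or_nontrivial N with h | h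
  · exact Or.inl (Submodule.eq_bot_of_subsingleton)
  · right
    apply Submodule.eq_top_of_finrank_eq
    refine le_antisymm (Submodule.finrank_le N) ?_
    rw [hd]
    exact Nat.find_min' hex ⟨M.ofSubmodule N h₁ h₂, h, rfl⟩

theorem IsSimple.surjective {M N : CohMod A} (hN : N.IsSimple) {f : M ⟶ N} (hf : f ≠ 0) :
    Function.Surjective f.1 := by
  rw [← LinearMap.range_eq_top]
  refine (hN.eq_bot_or_eq_top (LinearMap.range f.1) ?_ ?_).resolve_left fun h => hf ?_
  · rintro a _ ⟨x, rfl⟩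
    exact ⟨MulOpposite.op a • x, f.2.1 a x⟩
  · rintro g _ ⟨x, rfl⟩
    exact ⟨M.act g x, f.2.2 g x⟩
  · exact Subtype.ext (LinearMap.range_eq_bot.1 h)

theorem IsSimple.simple {M : CohMod A} (hM : M.IsSimple) : Simple M where
  mono_isIso_iff_nonzero {Y} f _ := by
    constructor
    · rintro h rfl
      have := hM.nontrivial
      obtain ⟨x, hx⟩ := exists_ne (0 : M.carrier)
      obtain ⟨y, rfl⟩ := (bijective_of_isIso (0 : Y ⟶ M)).2 x
      exact hx rfl
    · exact fun h => isIso_of_bijective f ⟨injective_of_mono f, hM.surjective h⟩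

theorem isSimple_of_simple (M : CohMod A) [Simple M] : M.IsSimple := by
  constructor
  · by_contra h
    rw [not_nontrivial_iff_subsingleton] at h
    exact id_nonzero M (hom_ext fun x => Subsingleton.elim _ _)
  · intro N h₁ h₂
    by_cases h : M.ofSubmoduleι N h₁ h₂ = 0
    · left
      rw [eq_bot_iff]
      intro x hx
      exact DFunLike.congr_fun (congrArg Subtype.val h) (⟨x, hx⟩ : N)
    · right
      have := mono_of_injective (M.ofSubmoduleι N h₁ h₂) Subtype.val_injective
      have := isIso_of_mono_of_nonzero h
      rw [eq_top_iff]
      intro x _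
      obtain ⟨y, rfl⟩ := (bijective_of_isIso (M.ofSubmoduleι N h₁ h₂)).2 x
      exact y.2

/-- The endomorphism algebra of an object acts on it. -/
instance (M : CohMod A) : Module (End M) M.carrier where
  smul f x := f.1 x
  one_smul _ := rfl
  mul_smul _ _ _ := rfl
  smul_zero f := map_zero f.1
  smul_add f := map_add f.1
  add_smul _ _ _ := rfl
  zero_smul _ := rfl

theorem IsSimple.isUnit_or_eq_zero {M : CohMod A} (hM : M.IsSimple) (f : End M) :
    IsUnit f ∨ f = 0 := by
  by_cases h : f = 0
  · exact Or.inr h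
  · left
    have h1 := hM.surjective (f := f) h
    have : IsIso (show M ⟶ M from f) :=
      isIso_of_bijective f ⟨LinearMap.injective_iff_surjective.2 h1, h1⟩
    exact (isUnit_iff_isIso f).2 this

end CohMod

/-- D is End(M), a division ring by Schur's lemma. It acts on the image N of M through the functor:
fullness makes D exhaust End(N), and k-linearity makes the two k-structures agree. -/
theorem MoritaEquivalent.exists_end {A B : AlgebraSheaf G k} [Module.Finite k A.carrier]
    [Nontrivial A.carrier] (h : MoritaEquivalent A B) :
    ∃ (M : CohMod A) (N : CohMod B) (D : Type u) (_ : DivisionRing D) (_ : Algebra k D)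
      (_ : Module D M.carrier) (_ : Module D N.carrier), Module.Finite k D ∧
      IsScalarTower k D M.carrier ∧ IsScalarTower k D N.carrier ∧ IsSimpleWithEnd M D ∧
      IsSimpleWithEnd N D := by
  obtain ⟨e, hadd, hlin⟩ := h
  obtain ⟨M, hM⟩ := CohMod.exists_isSimple A
  have := hM.simple
  have := hM.nontrivial
  have := CategoryTheory.simple_obj e.functor M
  have hN := CohMod.isSimple_of_simple (e.functor.obj M)
  let N := e.functor.obj M
  let _ : DivisionRing (CategoryTheory.End M) :=
    DivisionRing.ofIsUnitOrEqZero hM.isUnit_or_eq_zero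
  let φ : CategoryTheory.End M →+* CategoryTheory.End N :=
    { toFun := fun f => e.functor.map f
      map_one' := e.functor.map_id M
      map_mul' := fun f f' => e.functor.map_comp f' f
      map_zero' := e.functor.map_zero M M
      map_add' := fun f f' => e.functor.map_add }
  let _ : Module (CategoryTheory.End M) N.carrier := Module.compHom N.carrier φ
  have hφ : ∀ (f : CategoryTheory.End M) (x : N.carrier), f • x = (e.functor.map f).1 x :=
    fun _ _ => rfl
  refine ⟨M, N, CategoryTheory.End M, inferInstance, inferInstance, inferInstance, inferInstance,
    ?_, ?_, ?_, ?_, ?_⟩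
  · exact Module.Finite.of_injective (CohMod.homs M M).subtype Subtype.val_injective
  · exact ⟨fun c f x => rfl⟩
  · refine ⟨fun c f x => ?_⟩
    rw [hφ, hφ]
    have := e.functor.map_smul (R := k) (X := M) (Y := M) c f
    exact DFunLike.congr_fun (congrArg Subtype.val this) x
  · exact ⟨hM.nontrivial, hM.eq_bot_or_eq_top, fun f a x => f.2.1 a x,
      fun g f x => (f.2.2 g x).symm, fun f hf => ⟨⟨f, hf⟩, fun _ => rfl⟩⟩
  · refine ⟨hN.nontrivial, hN.eq_bot_or_eq_top, fun f a x => (e.functor.map f).2.1 a x,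
      fun g f x => ((e.functor.map f).2.2 g x).symm, fun f hf => ?_⟩
    obtain ⟨f', hf'⟩ := e.functor.map_surjective (X := M) (Y := M) ⟨f, hf⟩
    refine ⟨f', fun x => ?_⟩
    rw [hφ, hf']

end ClassifyingStack

/-! ### Equality of the orders -/

theorem corollary4p14 {k : Type u} [Field k] (n : ℕ) (hn : (n : k) ≠ 0)
    (hk : (Polynomial.X ^ n - 1 : Polynomial k).Splits)
    (A B : ClassifyingStack.Azumaya (rootsOfUnity n k) k)
    (hAB : ClassifyingStack.MoritaEquivalent A.toAlgebraSheaf B.toAlgebraSheaf) :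
    addOrderOf A.brauerClass = addOrderOf B.brauerClass := by
  have : NeZero n := ⟨fun h => hn (by rw [h, Nat.cast_zero])⟩
  obtain ⟨ζ, hζ⟩ := ClassifyingStack.exists_isPrimitiveRoot hn hk
  have := A.isAzumaya.finite
  have := A.isAzumaya.nontrivial
  obtain ⟨M, N, D, _, _, _, _, _, _, _, hM, hN⟩ := hAB.exists_end
  obtain ⟨g, hg⟩ := IsCyclic.exists_monoid_generator (α := rootsOfUnity n k)
  obtain ⟨e, he, hA, hB⟩ := ClassifyingStack.exists_nsmul_eq hM hN hn hζ (g := g) (fun h => hg h)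
    fun h => Subtype.ext ((mem_rootsOfUnity n (h : kˣ)).1 h.2)
  have key : ∀ X Y : ClassifyingStack.Br (rootsOfUnity n k) k, e • X = e • Y →
      (∀ m : ℕ, m • X = 0 → e ∣ m) → addOrderOf Y ∣ addOrderOf X := fun X Y hXY hX => by
    -- Write the order of X as ed; then (ed)Y = d(eY) = d(eX) = 0.
    obtain ⟨d, hd⟩ := hX _ (addOrderOf_nsmul_eq_zero X)
    apply addOrderOf_dvd_of_nsmul_eq_zero
    rw [hd, mul_comm, mul_nsmul', ← hXY, ← mul_nsmul', mul_comm, ← hd, addOrderOf_nsmul_eq_zero]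
  exact Nat.dvd_antisymm (key _ _ he.symm hB) (key _ _ he hA)
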